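/- Let $\Xi=\{\xi_k\}_{k\in\mathbb Z}$ be a centered, stationary, circularly symmetric complex Gaussian process with covariance function $\gamma(k-l)=\mathbb E[\xi_k\overline{\xi_l}]$ (and $\mathbb E[\xi_k\xi_l]=0$) for all $k,l\in\mathbb Z$, normalized by $\gamma(0)=1$. Let $F$ be its spectral measure, i.e. the probability measure on $(-\pi,\pi]$ with $\gamma(k)=\int_{(-\pi,\pi]}e^{-ikt}\,F(dt)$ for all $k\in\mathbb Z$. Let $X_\Xi(z)=\sum_{k=0}^\infty \xi_k z^k$, and let $\mathcal Z=\sum_{z\in\mathbb D:\,X_\Xi(z)=0}\delta_z$ be the point process of its zeros in the open unit disk $\mathbb D=\{z\in\mathbb C:|z|<1\}$. For $0\le r<1$ let $$P_r(s)=\frac{1-r^2}{1-2r\cos s+r^2}$$ be the Poisson kernel, and for $\phi\in\mathbb R$ let $F_\phi(ds)=F(d(s+\phi))$ be the rotated measure on $(-\pi,\pi]$ modulo $2\pi$. Then $\mathcal Z$ has a continuous first intensity $\rho_1:\mathbb D\to[0,\infty)$ with respect to Lebesgue measure $m$ on $\mathbb C$, i.e. $\mathbb E[\mathcal Z(A)]=\int_A\rho_1(z)\,m(dz)$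 for every Borel set $A\subseteq\mathbb D$ (both sides may be $+\infty$), and for every $z=re^{i\phi}$ with $0\le r<1$ and $\phi\in\mathbb R$, $$\rho_1(re^{i\phi})=\frac{1}{\pi(1-r^2)^2}\cdot\frac{\displaystyle\int_{(-\pi,\pi]}\int_{(-\pi,\pi]}\{1-\cos(t-s)\}\,P_r(s)^2P_r(t)^2\,F_\phi(ds)\,F_\phi(dt)}{\Big(\displaystyle\int_{(-\pi,\pi]}P_r(s)\,F_\phi(ds)\Big)^2}.$$ -/

import Mathlib

open MeasureTheory ProbabilityTheory Set
open scoped Real ENNReal ComplexConjugate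

noncomputable section

namespace GaussianPowerSeries

/-- `ξ = (ξ_k)_{k ∈ ℤ}` is a centered stationary (circularly symmetric) complex Gaussian process
with covariance function `γ(k - l) = 𝔼[ξ_k conj(ξ_l)]`, normalized by `γ(0) = 1`, so that every
`ξ_k` is a standard complex normal random variable. As usual for complex Gaussian processes, the
pseudo-covariances `𝔼[ξ_k ξ_l]` vanish. -/
structure IsStationaryComplexGaussian {Ω : Type*} [MeasurableSpace Ω] (P : Measure Ω)
    (ξ : ℤ → Ω → ℂ) (γ : ℤ → ℂ) : Prop where
  gaussian : IsGaussianProcess ξ P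
  centered : ∀ k, ∫ ω, ξ k ω ∂P = 0
  circular : ∀ k l, ∫ ω, ξ k ω * ξ l ω ∂P = 0
  covariance : ∀ k l, ∫ ω, ξ k ω * conj (ξ l ω) ∂P = γ (k - l)
  normalized : γ 0 = 1

/-- `F` is the spectral measure of the covariance function `γ`: a probability measure carried by
`(-π, π]` with `γ(k) = ∫ e^{-ikt} F(dt)` for all `k ∈ ℤ`. -/
structure IsSpectralMeasure (F : Measure ℝ) (γ : ℤ → ℂ) : Prop where
  isProbabilityMeasure : IsProbabilityMeasure F
  carried : F (Ioc (-π) π)ᶜ = 0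
  fourier : ∀ k : ℤ, γ k = ∫ t in Ioc (-π) π, Complex.exp (-Complex.I * k * t) ∂F

/-- The open unit disk of the complex plane. -/
def unitDisk : Set ℂ := {z | ‖z‖ < 1}

/-- The random power series `X_Ξ(z) = ∑_{k ≥ 0} ξ_k z^k`. -/
def powerSeries {Ω : Type*} (ξ : ℤ → Ω → ℂ) (ω : Ω) (z : ℂ) : ℂ :=
  ∑' k : ℕ, ξ (k : ℤ) ω * z ^ k

/-- The zeros of `X_Ξ` in the open unit disk. -/
def zeroSet {Ω : Type*} (ξ : ℤ → Ω → ℂ) (ω : Ω) : Set ℂ :=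
  {z | z ∈ unitDisk ∧ powerSeries ξ ω z = 0}

/-- The zero process `∑_{z ∈ 𝔻 : X_Ξ(z) = 0} δ_z`, as a random measure on `ℂ`. -/
def zeroProcess {Ω : Type*} (ξ : ℤ → Ω → ℂ) (ω : Ω) : Measure ℂ :=
  Measure.sum fun z : zeroSet ξ ω => Measure.dirac (z : ℂ)

/-- `ρ` is a first intensity (one-point density) on `D ⊆ ℂ`, with respect to Lebesgue measure, of
the random measure `Z`: `𝔼[Z(A)] = ∫_A ρ(z) m(dz)` for all Borel sets `A ⊆ D`, both sides being
allowed to be infinite. -/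
structure IsFirstIntensityOn {Ω : Type*} [MeasurableSpace Ω] (P : Measure Ω)
    (Z : Ω → Measure ℂ) (D : Set ℂ) (ρ : ℂ → ℝ) : Prop where
  nonneg : ∀ z ∈ D, 0 ≤ ρ z
  aemeasurable_count : ∀ A ⊆ D, MeasurableSet A → AEMeasurable (fun ω => Z ω A) P
  mean_count : ∀ A ⊆ D, MeasurableSet A →
    ∫⁻ ω, Z ω A ∂P = ∫⁻ z in A, ENNReal.ofReal (ρ z) ∂volume

/-- The Poisson kernel `P_r(s) = (1 - r²) / (1 - 2 r cos s + r²)`. -/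
def poissonKernel (r s : ℝ) : ℝ := (1 - r ^ 2) / (1 - 2 * r * Real.cos s + r ^ 2)

/-- Subtracting `φ` modulo `2π`, with values in `(-π, π]`. -/
def shiftMod (φ t : ℝ) : ℝ := toIocMod Real.two_pi_pos (-π) (t - φ)

lemma measurable_shiftMod (φ : ℝ) : Measurable (shiftMod φ) := by
  unfold shiftMod
  simp only [toIocMod, toIocDiv_eq_neg_floor, zsmul_eq_mul]
  fun_prop

/-- The rotated measure `F_φ(ds) = F(d(s + φ))` on `(-π, π]` modulo `2π`, i.e.
`F_φ(B) = F(B + φ mod 2π)`. -/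
def rotate (F : Measure ℝ) (φ : ℝ) : Measure ℝ := F.map (shiftMod φ)

end GaussianPowerSeries

end

noncomputable section

namespace GaussianPowerSeries

/-! ### Laws of circularly symmetric complex Gaussian variables. -/

section Gaussian

variable {Ω : Type*} [MeasurableSpace Ω] {P : Measure Ω}

/-! Put `h(z) = ∑ γ(k) z^k`. Regressing each coefficient on `ξ_0` splits the series as `X = Y + ξ_0
h`, where `Y` has coefficients `ξ_k - ξ_0 γ(k)`. These are uncorrelated with `ξ_0`, hence,
everything being jointly Gaussian, independent of it (`indepFun_residual`). Since `h(z) = ∫ F(dt) /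
(1 - z e^{-it})` has real part at least `1/2`, it has no zero in the disk, so the zeros of `X` are
the solutions of `g = ξ_0` for the holomorphic function `g = -Y / h`. Given `Y`, the level `ξ_0` is
still standard complex normal, with density `p`, and the area formula
(`lintegral_mul_pointMeasure_fiber`) gives `∫_A p(g) |g'|²` for the mean number of solutions in `A`.
Averaging over `Y` yields the intensity `𝔼[p(g(z)) |g'(z)|²]`. Multiplicities play no role: critical
values form a null set of levels.

It remains to compute this expectation. Both `U = g(z)` and `V = g'(z)` are linear forms in `ξ`, so
`(U, V)` is Gaussian, and regressing `V` on `U` expresses `𝔼[exp(-|U|²) |V|²]` through covariances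
(`integral_exp_neg_norm_sq_mul_norm_sq`). The isometry `ξ_k ↦ e^{-ikt}` into `L²(F)` turns the
covariances into integrals of the Szegő kernel `S = 1 / (1 - z e^{-it})` and its derivative `S' =
e^{-it} S²`. The terms in `h` cancel, leaving the Gram determinant of `S, S'` divided by `(∫ |S|²)²`
(`gram_ratio`). As `S = S² - z S'`, a shear replaces `S` by `S²` in that determinant (`gram_shear`),
which becomes `(∫ |S|⁴)² - |∫ |S|⁴ e^{it}|²`. This is the double integral of `1 - cos(t - s)`
against `|S|⁴ |S|⁴`, and `(1 - r²) |S|²` is the Poisson kernel.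

The counts are shown to be measurable on the space of coefficient sequences, so that Tonelli applies
to the pair `(ξ_0, Y)`. -/

lemma integral_complex_re {f : Ω → ℂ} (hf : Integrable f P) :
    ∫ ω, (f ω).re ∂P = (∫ ω, f ω ∂P).re :=
  Complex.reCLM.integral_comp_comm hf

lemma memLp_conj {f : Ω → ℂ} (hf : MemLp f 2 P) : MemLp (fun ω => conj (f ω)) 2 P :=
  hf.congr_norm (Complex.continuous_conj.comp_aestronglyMeasurable hf.1) (by simp)

lemma integrable_norm_sq {f : Ω → ℂ} (hf : MemLp f 2 P) : Integrable (fun ω => ‖f ω‖ ^ 2) P := by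
  simpa using hf.integrable_norm_pow (by norm_num)

/-- Two centered square integrable complex random variables with vanishing covariance and
pseudo-covariance have uncorrelated real-linear images. -/
lemma covariance_inner_eq_zero [IsProbabilityMeasure P] {U W : Ω → ℂ} (hU : MemLp U 2 P)
    (hW : MemLp W 2 P) (h0 : ∫ ω, U ω ∂P = 0) (h1 : ∫ ω, U ω * W ω ∂P = 0)
    (h2 : ∫ ω, U ω * conj (W ω) ∂P = 0) (x y : ℂ) :
    cov[fun ω => inner ℝ x (U ω), fun ω => inner ℝ y (W ω); P] = 0 := by
  have hm : ∀ (x : ℂ) {U : Ω → ℂ}, MemLp U 2 P → MemLp (fun ω => inner ℝ x (U ω)) 2 P :=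
    fun x U hU => hU.const_inner x
  rw [covariance_eq_sub (hm x hU) (hm y hW)]
  have hi1 : Integrable (fun ω => U ω * W ω) P := hU.integrable_mul hW
  have hi2 : Integrable (fun ω => U ω * conj (W ω)) P := hU.integrable_mul (memLp_conj hW)
  have e1 : ∫ ω, inner ℝ x (U ω) ∂P = 0 := by
    have : ∀ ω, inner ℝ x (U ω) = (conj x * U ω).re := fun ω => by
      simp [Complex.inner]; ring
    simp_rw [this]
    rw [integral_complex_re ((hU.integrable (by norm_num)).const_mul _), integral_const_mul, h0]
    simp
  have e2 : ∫ ω, inner ℝ x (U ω) * inner ℝ y (W ω) ∂P = 0 := by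
    -- Polarization: `Re p · Re q = Re (p q + p conj q) / 2`. Vanishing of both the covariance and
    -- the pseudo-covariance is therefore what is needed.
    have : ∀ ω, inner ℝ x (U ω) * inner ℝ y (W ω) =
        ((conj x * conj y / 2) * (U ω * W ω) + (conj x * y / 2) * (U ω * conj (W ω))).re := by
      intro ω
      simp [Complex.inner]
      ring
    simp_rw [this]
    rw [integral_complex_re (f := fun ω => _ * (U ω * W ω) + _ * (U ω * conj (W ω))) ((hi1.const_mul _).add (hi2.const_mul _)),
      integral_add (hi1.const_mul _) (hi2.const_mul _), integral_const_mul, integral_const_mul,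
      h1, h2]
    simp
  simp only [Pi.mul_apply] at *
  rw [e2, e1]
  simp

/-- The density of the complex normal distribution with variance `a`. -/
def complexNormalDensity (a : ℝ) (u : ℂ) : ℝ := 1 / (π * a) * Real.exp (-(1 / a) * ‖u‖ ^ 2)

lemma continuous_complexNormalDensity (a : ℝ) : Continuous (complexNormalDensity a) := by
  unfold complexNormalDensity
  fun_prop

lemma complexNormalDensity_nonneg {a : ℝ} (ha : 0 < a) (u : ℂ) : 0 ≤ complexNormalDensity a u := by
  unfold complexNormalDensity
  positivity

lemma complexNormalDensity_eq_mul {a : ℝ} (ha : 0 < a) (x y : ℝ) :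
    complexNormalDensity a ⟨x, y⟩ =
      gaussianPDFReal 0 (a / 2).toNNReal x * gaussianPDFReal 0 (a / 2).toNNReal y := by
  have hv : (((a / 2).toNNReal : NNReal) : ℝ) = a / 2 := Real.coe_toNNReal _ (by positivity)
  simp only [complexNormalDensity, gaussianPDFReal, hv, sub_zero]
  rw [mul_mul_mul_comm, ← Real.exp_add, ← mul_inv, Real.mul_self_sqrt (by positivity),
    Complex.sq_norm, Complex.normSq_mk]
  congr 1
  · rw [one_div]; congr 1; ring
  · congr 1; field_simp; ring

/-- The law of a centered circularly symmetric complex Gaussian variable. -/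
lemma map_eq_withDensity_of_circular {U : Ω → ℂ} (hU : HasGaussianLaw U P)
    (h0 : ∫ ω, U ω ∂P = 0) (h1 : ∫ ω, U ω * U ω ∂P = 0) {a : ℝ} (ha : 0 < a)
    (h2 : ∫ ω, ‖U ω‖ ^ 2 ∂P = a) :
    P.map U = volume.withDensity fun u => ENNReal.ofReal (complexNormalDensity a u) := by
  have := hU.isProbabilityMeasure
  have hL := hU.memLp_two
  have hi := hL.integrable (by norm_num)
  have hi1 : Integrable (fun ω => U ω * U ω) P := hL.integrable_mul hL
  have hi2 := integrable_norm_sq hL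
  have hre : HasGaussianLaw (fun ω => (U ω).re) P := hU.map_fun Complex.reCLM
  have him : HasGaussianLaw (fun ω => (U ω).im) P := hU.map_fun Complex.imCLM
  have hprod : HasGaussianLaw (fun ω => ((U ω).re, (U ω).im)) P :=
    hU.map_equiv_fun Complex.equivRealProdCLM
  have m0 : ∫ ω, (U ω).re ∂P = 0 := by rw [integral_complex_re hi, h0]; simp
  have m0' : ∫ ω, (U ω).im ∂P = 0 := by
    rw [show ∫ ω, (U ω).im ∂P = (∫ ω, U ω ∂P).im from Complex.imCLM.integral_comp_comm hi, h0]; simp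
  -- The real part of `𝔼[U²] = 0` makes the two coordinates equally spread, its imaginary part makes
  -- them uncorrelated; `𝔼|U|² = a` then fixes each variance at `a / 2`.
  have e1 : ∫ ω, ((U ω).re ^ 2 - (U ω).im ^ 2) ∂P = 0 := by
    have := integral_complex_re hi1
    rw [h1] at this
    simpa [sq] using this
  have e2 : ∫ ω, (U ω).re * (U ω).im ∂P = 0 := by
    have : ∫ ω, (U ω * U ω).im ∂P = _ := Complex.imCLM.integral_comp_comm hi1
    simp only [Complex.imCLM_apply, h1, Complex.mul_im, Complex.zero_im] at this
    have h3 : ∀ ω, (U ω).re * (U ω).im + (U ω).im * (U ω).re = 2 * ((U ω).re * (U ω).im) :=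
      fun ω => by ring
    simp_rw [h3] at this
    rw [integral_const_mul] at this
    linarith
  have e3 : ∫ ω, ((U ω).re ^ 2 + (U ω).im ^ 2) ∂P = a := by
    rw [← h2]
    congr with ω
    rw [Complex.sq_norm, Complex.normSq_apply]; ring
  have ir := hre.memLp_two.integrable_sq
  have ii := him.memLp_two.integrable_sq
  rw [integral_sub ir ii] at e1
  rw [integral_add ir ii] at e3
  have vr : Var[fun ω => (U ω).re; P] = a / 2 := by
    rw [variance_of_integral_eq_zero hre.aemeasurable m0]; linarith
  have vi : Var[fun ω => (U ω).im; P] = a / 2 := by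
    rw [variance_of_integral_eq_zero him.aemeasurable m0']; linarith
  have hind : IndepFun (fun ω => (U ω).re) (fun ω => (U ω).im) P := by
    refine hprod.indepFun_of_covariance_eq_zero ?_
    rw [covariance_eq_sub hre.memLp_two him.memLp_two]
    simp [m0, e2]
  have hv : (a / 2).toNNReal ≠ 0 := by simpa using ha
  have hlaw : P.map (fun ω => ((U ω).re, (U ω).im)) =
      (volume : Measure (ℝ × ℝ)).withDensity fun p =>
        ENNReal.ofReal (complexNormalDensity a ⟨p.1, p.2⟩) := by
    rw [(indepFun_iff_map_prod_eq_prod_map_map hre.aemeasurable him.aemeasurable).1 hind,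
      hre.map_eq_gaussianReal, him.map_eq_gaussianReal, vr, vi, m0, m0',
      gaussianReal_of_var_ne_zero _ hv, prod_withDensity (by fun_prop) (by fun_prop)]
    congr 1
    ext p
    rw [complexNormalDensity_eq_mul ha, ENNReal.ofReal_mul (gaussianPDFReal_nonneg _ _ _)]
    rfl
  have hmp := Complex.volume_preserving_equiv_real_prod
  have hU' : P.map U = (P.map (fun ω => ((U ω).re, (U ω).im))).map
      Complex.measurableEquivRealProd.symm := by
    rw [AEMeasurable.map_map_of_aemeasurable (by fun_prop) hprod.aemeasurable]
    rfl
  rw [hU', hlaw]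
  ext s hs
  rw [Measure.map_apply (by fun_prop) hs, withDensity_apply _ hs, withDensity_apply _
    (Complex.measurableEquivRealProd.symm.measurable hs),
    ← hmp.symm.setLIntegral_comp_preimage hs
      (continuous_complexNormalDensity a).measurable.ennreal_ofReal]
  rfl

/-- A radial Gamma integral: the extra weight merely changes the exponent `1 / a` into `1 / a + 1`.
Only `q = 0` and `q = 1` are used. -/
lemma integral_complexNormal {a : ℝ} (ha : 0 < a) (q : ℕ) :
    ∫ u : ℂ, complexNormalDensity a u * (‖u‖ ^ (2 * q) * Real.exp (-‖u‖ ^ 2)) =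
      1 / a * (a / (1 + a)) ^ (q + 1) * q.factorial := by
  have h := Complex.integral_rpow_mul_exp_neg_mul_rpow (p := 2) (q := 2 * q) (b := 1 / a + 1)
    (by norm_num) (by have : (0 : ℝ) ≤ q := by positivity
                      linarith) (by positivity)
  have e : ∀ u : ℂ, complexNormalDensity a u * (‖u‖ ^ (2 * q) * Real.exp (-‖u‖ ^ 2)) =
      1 / (π * a) * (‖u‖ ^ (2 * q : ℝ) * Real.exp (-(1 / a + 1) * ‖u‖ ^ (2 : ℝ))) := by
    intro u
    have : ‖u‖ ^ (2 * q : ℝ) = ‖u‖ ^ (2 * q) := by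
      rw [← Real.rpow_natCast]; push_cast; rfl
    rw [this, Real.rpow_two, complexNormalDensity,
      show -(1 / a + 1) * ‖u‖ ^ 2 = -(1 / a) * ‖u‖ ^ 2 + -‖u‖ ^ 2 by ring, Real.exp_add]
    ring
  simp_rw [e]
  rw [integral_const_mul, h]
  have e1 : (2 * (q : ℝ) + 2) / 2 = q + 1 := by ring
  have e2 : -(2 * (q : ℝ) + 2) / 2 = -((q + 1 : ℕ) : ℝ) := by push_cast; ring
  rw [e1, e2, Real.Gamma_nat_eq_factorial, Real.rpow_neg (by positivity), Real.rpow_natCast,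
    ← inv_pow]
  have e3 : (1 / a + 1)⁻¹ = a / (1 + a) := by field_simp
  rw [e3]
  field_simp

end Gaussian

/-! ### Gaussian pairs, Gaussian limits and almost sure summability. -/

section GaussianPairs

variable {Ω : Type*} [MeasurableSpace Ω] {P : Measure Ω}

lemma integral_add_const_mul_add_two_re {f g : Ω → ℝ} {h : Ω → ℂ} (hf : Integrable f P)
    (hg : Integrable g P) (hh : Integrable h P) (r : ℝ) :
    ∫ ω, (f ω + r * g ω + 2 * (h ω).re) ∂P =
      ∫ ω, f ω ∂P + r * ∫ ω, g ω ∂P + 2 * (∫ ω, h ω ∂P).re := by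
  have hh' : Integrable (fun ω => 2 * (h ω).re) P := hh.re.const_mul 2
  rw [integral_add (f := fun ω => f ω + r * g ω) (hf.add (hg.const_mul r)) hh',
    integral_add hf (hg.const_mul r), integral_const_mul, integral_const_mul, integral_complex_re hh]

/-- For a jointly Gaussian pair `(U, V)` of centered circularly symmetric complex variables,
`𝔼[exp (-|U|²) |V|²]` in terms of the covariances. -/
lemma integral_exp_neg_norm_sq_mul_norm_sq {U V : Ω → ℂ}
    (hUV : HasGaussianLaw (fun ω => (U ω, V ω)) P)
    (hU0 : ∫ ω, U ω ∂P = 0) (hV0 : ∫ ω, V ω ∂P = 0) (hUU : ∫ ω, U ω * U ω ∂P = 0)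
    (hUV0 : ∫ ω, U ω * V ω ∂P = 0) :
    ∫ ω, Real.exp (-‖U ω‖ ^ 2) * ‖V ω‖ ^ 2 ∂P =
      ((∫ ω, ‖V ω‖ ^ 2 ∂P) * (1 + ∫ ω, ‖U ω‖ ^ 2 ∂P) - ‖∫ ω, V ω * conj (U ω) ∂P‖ ^ 2) /
        (1 + ∫ ω, ‖U ω‖ ^ 2 ∂P) ^ 2 := by
  have := hUV.isProbabilityMeasure
  have hU := hUV.fst
  have hV := hUV.snd
  have hU2 := hU.memLp_two
  have hV2 := hV.memLp_two
  have hnU := integrable_norm_sq hU2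
  have hnV := integrable_norm_sq hV2
  set a := ∫ ω, ‖U ω‖ ^ 2 ∂P with ha_def
  set b := ∫ ω, ‖V ω‖ ^ 2 ∂P with hb_def
  set c := ∫ ω, V ω * conj (U ω) ∂P with hc_def
  have ha0 : 0 ≤ a := integral_nonneg fun ω => by positivity
  rcases ha0.eq_or_lt with ha | ha
  -- In the degenerate case `U` has no density, but it vanishes almost surely and both sides reduce
  -- to `b`.
  · have hz : ∀ᵐ ω ∂P, U ω = 0 := by
      have := (integral_eq_zero_iff_of_nonneg (fun ω => by positivity) hnU).1 ha.symm
      filter_upwards [this] with ω hω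
      simpa using hω
    have hc : c = 0 := by
      rw [hc_def, ← integral_zero Ω ℂ]
      refine integral_congr_ae ?_
      filter_upwards [hz] with ω hω
      simp [hω]
    rw [hc, ← ha]
    simp only [add_zero, mul_one, norm_zero, ne_eq, OfNat.ofNat_ne_zero, not_false_eq_true,
      zero_pow, sub_zero, one_pow, div_one]
    refine integral_congr_ae ?_
    filter_upwards [hz] with ω hω
    simp [hω]
  -- The regression coefficient of `V` on `U`: with it, `W = V - κ U` is uncorrelated with `U`,
  -- hence independent of it.
  · set κ : ℂ := c / a with hκ
    set W : Ω → ℂ := fun ω => V ω - κ * U ω with hW_def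
    have hUconjU : ∫ ω, U ω * conj (U ω) ∂P = a := by
      rw [ha_def, ← integral_complex_ofReal]
      congr with ω
      rw [Complex.mul_conj, Complex.normSq_eq_norm_sq]
    have iUU : Integrable (fun ω => U ω * U ω) P := hU2.integrable_mul hU2
    have iUV : Integrable (fun ω => U ω * V ω) P := hU2.integrable_mul hV2
    have iUcU : Integrable (fun ω => U ω * conj (U ω)) P := hU2.integrable_mul (memLp_conj hU2)
    have iVcU : Integrable (fun ω => V ω * conj (U ω)) P := hV2.integrable_mul (memLp_conj hU2)
    have hUW : HasGaussianLaw (fun ω => (U ω, W ω)) P := by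
      let L : ℂ × ℂ →L[ℝ] ℂ × ℂ := (ContinuousLinearMap.fst ℝ ℂ ℂ).prod
        (ContinuousLinearMap.snd ℝ ℂ ℂ -
          (ContinuousLinearMap.mul ℝ ℂ κ).comp (ContinuousLinearMap.fst ℝ ℂ ℂ))
      exact hUV.map_fun L
    have hW2 : MemLp W 2 P := hUW.snd.memLp_two
    have hnW := integrable_norm_sq hW2
    have iW := hW2.integrable (by norm_num)
    have hW0 : ∫ ω, W ω ∂P = 0 := by
      rw [hW_def, integral_sub (hV2.integrable (by norm_num))
        ((hU2.integrable (by norm_num)).const_mul _), integral_const_mul, hU0, hV0]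
      simp
    have hUW0 : ∫ ω, U ω * W ω ∂P = 0 := by
      have : ∀ ω, U ω * W ω = U ω * V ω - κ * (U ω * U ω) := fun ω => by simp [hW_def]; ring
      simp_rw [this]
      rw [integral_sub iUV (iUU.const_mul _), integral_const_mul, hUV0, hUU]
      simp
    have hWcU : ∫ ω, W ω * conj (U ω) ∂P = 0 := by
      have : ∀ ω, W ω * conj (U ω) = V ω * conj (U ω) - κ * (U ω * conj (U ω)) :=
        fun ω => by simp [hW_def]; ring
      simp_rw [this]
      rw [integral_sub iVcU (iUcU.const_mul _), integral_const_mul, hUconjU, hκ]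
      have : (a : ℂ) ≠ 0 := by exact_mod_cast ha.ne'
      field_simp
      simp [hc_def]
    have hUcW : ∫ ω, U ω * conj (W ω) ∂P = 0 := by
      have h : ∫ ω, conj (W ω * conj (U ω)) ∂P = 0 := by rw [integral_conj, hWcU]; simp
      rw [← h]
      congr with ω
      simp [mul_comm]
    have hind : IndepFun U W P := hUW.indepFun_of_covariance_inner fun x y =>
      covariance_inner_eq_zero hU2 hW2 hU0 hUW0 hUcW x y
    have hnW_eq : ∫ ω, ‖W ω‖ ^ 2 ∂P = b - ‖c‖ ^ 2 / a := by
      have h1 : ∀ ω, ‖V ω‖ ^ 2 = ‖W ω‖ ^ 2 + ‖κ‖ ^ 2 * ‖U ω‖ ^ 2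
          + 2 * (conj κ * (W ω * conj (U ω))).re := fun ω => by
        have : V ω = W ω + κ * U ω := by simp [hW_def]
        rw [this, Complex.sq_norm, Complex.normSq_add, Complex.normSq_mul, Complex.sq_norm,
          Complex.sq_norm, Complex.sq_norm, map_mul]
        ring_nf
      have iWcU : Integrable (fun ω => W ω * conj (U ω)) P := hW2.integrable_mul (memLp_conj hU2)
      have h2 : b = ∫ ω, ‖W ω‖ ^ 2 ∂P + ‖κ‖ ^ 2 * a := by
        rw [hb_def]
        simp_rw [h1]
        refine (integral_add_const_mul_add_two_re hnW hnU (iWcU.const_mul _) _).trans ?_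
        rw [integral_const_mul, hWcU]
        simp [ha_def]
      have h4 : ‖κ‖ ^ 2 * a = ‖c‖ ^ 2 / a := by
        rw [hκ, norm_div, Complex.norm_real, Real.norm_of_nonneg ha0]
        field_simp
      rw [← h4, h2]
      ring
    have hlaw := map_eq_withDensity_of_circular hU hU0 hUU ha rfl
    have hE : ∀ q : ℕ, ∫ ω, ‖U ω‖ ^ (2 * q) * Real.exp (-‖U ω‖ ^ 2) ∂P =
        1 / a * (a / (1 + a)) ^ (q + 1) * q.factorial := fun q => by
      have hg : Continuous fun u : ℂ => ‖u‖ ^ (2 * q) * Real.exp (-‖u‖ ^ 2) := by fun_prop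
      rw [← integral_complexNormal ha q,
        ← integral_map (φ := U) (f := fun u => ‖u‖ ^ (2 * q) * Real.exp (-‖u‖ ^ 2))
          hU.aemeasurable hg.aestronglyMeasurable, hlaw,
        integral_withDensity_eq_integral_toReal_smul
          (continuous_complexNormalDensity a).measurable.ennreal_ofReal (by simp)]
      congr with u
      rw [ENNReal.toReal_ofReal (complexNormalDensity_nonneg ha u), smul_eq_mul]
    have hE0 := hE 0
    have hE1 := hE 1
    simp only [mul_zero, pow_zero, one_mul, zero_add, pow_one, Nat.factorial, Nat.cast_one,
      mul_one] at hE0 hE1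
    have me : Measurable fun u : ℂ => Real.exp (-‖u‖ ^ 2) := by fun_prop
    have i1 : ∫ ω, Real.exp (-‖U ω‖ ^ 2) * ‖W ω‖ ^ 2 ∂P =
        (1 / a * (a / (1 + a))) * (b - ‖c‖ ^ 2 / a) := by
      rw [hind.integral_fun_comp_mul_comp (f := fun u => Real.exp (-‖u‖ ^ 2))
        (g := fun w => ‖w‖ ^ 2) hU.aemeasurable hUW.snd.aemeasurable
        me.aestronglyMeasurable (by fun_prop), hE0, hnW_eq]
    have bdd : ∀ u : ℂ, ‖((Real.exp (-‖u‖ ^ 2) : ℝ) : ℂ)‖ ≤ 1 := fun u => by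
      rw [Complex.norm_real, Real.norm_of_nonneg (Real.exp_nonneg _)]
      exact Real.exp_le_one_iff.2 (by simp)
    have bdd' : ∀ u : ℂ, ‖Real.exp (-‖u‖ ^ 2)‖ ≤ 1 := fun u => by
      simpa only [Complex.norm_real] using bdd u
    have mU : AEStronglyMeasurable (fun ω => ((Real.exp (-‖U ω‖ ^ 2) : ℝ) : ℂ)) P := by
      have := hU.aemeasurable
      fun_prop
    have mU' : AEStronglyMeasurable (fun ω => Real.exp (-‖U ω‖ ^ 2)) P := by
      have := hU.aemeasurable
      fun_prop
    -- The cross term in `|W + κ U|²` disappears, by independence and `𝔼 W = 0`.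
    have i2 : ∫ ω, W ω * (((Real.exp (-‖U ω‖ ^ 2) : ℝ) : ℂ) * conj (U ω)) ∂P = 0 := by
      refine (hind.symm.integral_fun_comp_mul_comp (f := id)
        (g := fun u => ((Real.exp (-‖u‖ ^ 2) : ℝ) : ℂ) * conj u)
        hUW.snd.aemeasurable hU.aemeasurable (by fun_prop) ?_).trans ?_
      · have : Continuous fun u : ℂ => ((Real.exp (-‖u‖ ^ 2) : ℝ) : ℂ) * conj u := by fun_prop
        exact this.aestronglyMeasurable
      · simp [hW0]
    have j2 : Integrable (fun ω => W ω * (((Real.exp (-‖U ω‖ ^ 2) : ℝ) : ℂ) * conj (U ω))) P := by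
      have hm : MemLp (fun ω => ((Real.exp (-‖U ω‖ ^ 2) : ℝ) : ℂ) * conj (U ω)) 2 P :=
        (memLp_conj hU2).of_le (mU.mul (memLp_conj hU2).1) (.of_forall fun ω => by
          rw [norm_mul]
          exact mul_le_of_le_one_left (norm_nonneg _) (bdd _))
      exact hW2.integrable_mul hm
    have i3 : ∫ ω, Real.exp (-‖U ω‖ ^ 2) * ‖U ω‖ ^ 2 ∂P = 1 / a * (a / (1 + a)) ^ 2 := by
      simp_rw [mul_comm (Real.exp _)]
      rw [hE1]
    have j1 : Integrable (fun ω => Real.exp (-‖U ω‖ ^ 2) * ‖W ω‖ ^ 2) P :=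
      hnW.bdd_mul mU' (.of_forall fun ω => bdd' _)
    have j3 : Integrable (fun ω => Real.exp (-‖U ω‖ ^ 2) * ‖U ω‖ ^ 2) P :=
      hnU.bdd_mul mU' (.of_forall fun ω => bdd' _)
    have h1 : ∀ ω, Real.exp (-‖U ω‖ ^ 2) * ‖V ω‖ ^ 2 = Real.exp (-‖U ω‖ ^ 2) * ‖W ω‖ ^ 2
        + ‖κ‖ ^ 2 * (Real.exp (-‖U ω‖ ^ 2) * ‖U ω‖ ^ 2)
        + 2 * (conj κ * (W ω * (((Real.exp (-‖U ω‖ ^ 2) : ℝ) : ℂ) * conj (U ω)))).re := fun ω => by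
      have h2 : conj κ * (W ω * (((Real.exp (-‖U ω‖ ^ 2) : ℝ) : ℂ) * conj (U ω))) =
        ((Real.exp (-‖U ω‖ ^ 2) : ℝ) : ℂ) * (conj κ * (W ω * conj (U ω))) := by ring
      rw [h2, Complex.re_ofReal_mul]
      have : V ω = W ω + κ * U ω := by simp [hW_def]
      rw [this, Complex.sq_norm (W ω + _), Complex.normSq_add, Complex.normSq_mul,
        Complex.sq_norm (W ω), Complex.sq_norm κ, Complex.sq_norm (U ω), map_mul]
      ring_nf
    simp_rw [h1]
    refine (integral_add_const_mul_add_two_re j1 j3 (j2.const_mul _) _).trans ?_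
    rw [integral_const_mul, i2, i1, i3, hκ, norm_div, Complex.norm_real, Real.norm_of_nonneg ha0]
    simp only [mul_zero, Complex.zero_re, add_zero]
    field_simp
    ring

/-- An almost sure limit of Gaussian variables, with dominated squares, is Gaussian. -/
lemma hasGaussianLaw_of_tendsto {E : Type*} [NormedAddCommGroup E] [NormedSpace ℝ E]
    [MeasurableSpace E] [BorelSpace E]
    {X : ℕ → Ω → E} {Y : Ω → E} {Q : Ω → ℝ} (hX : ∀ n, HasGaussianLaw (X n) P)
    (hQ : Integrable Q P) (hb : ∀ n, ∀ᵐ ω ∂P, ‖X n ω‖ ^ 2 ≤ Q ω)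
    (hlim : ∀ᵐ ω ∂P, Filter.Tendsto (fun n => X n ω) Filter.atTop (nhds (Y ω))) :
    HasGaussianLaw Y P := by
  have := (hX 0).isProbabilityMeasure
  have hY : AEMeasurable Y P :=
    aemeasurable_of_tendsto_metrizable_ae _ (fun n => (hX n).aemeasurable) hlim
  have hbY : ∀ᵐ ω ∂P, ‖Y ω‖ ^ 2 ≤ Q ω := by
    filter_upwards [ae_all_iff.2 hb, hlim] with ω h1 h2
    exact le_of_tendsto ((h2.norm).pow 2) (.of_forall h1)
  rw [hasGaussianLaw_iff_charFunDual_map_eq hY]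
  intro L
  have hmX : ∀ n, AEMeasurable (fun ω => L (X n ω)) P := fun n =>
    L.measurable.comp_aemeasurable (hX n).aemeasurable
  have hmY : AEMeasurable (fun ω => L (Y ω)) P := L.measurable.comp_aemeasurable hY
  have hLlim : ∀ᵐ ω ∂P, Filter.Tendsto (fun n => L (X n ω)) Filter.atTop (nhds (L (Y ω))) := by
    filter_upwards [hlim] with ω h
    exact (L.continuous.tendsto _).comp h
  have hsq : ∀ (e : E) {q : ℝ}, ‖e‖ ^ 2 ≤ q → ‖L e‖ ^ 2 ≤ ‖L‖ ^ 2 * q := fun e q h => by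
    calc ‖L e‖ ^ 2 ≤ (‖L‖ * ‖e‖) ^ 2 := by gcongr; exact L.le_opNorm e
      _ = ‖L‖ ^ 2 * ‖e‖ ^ 2 := by ring
      _ ≤ _ := by gcongr
  have hQ2 : Integrable (fun ω => ‖L‖ ^ 2 * Q ω) P := hQ.const_mul _
  -- The Gaussian form of the characteristic function survives the limit, since the function itself,
  -- the means and the variances all converge by domination.
  have c1 : Filter.Tendsto (fun n => charFunDual (P.map (X n)) L) Filter.atTop
      (nhds (charFunDual (P.map Y) L)) := by
    have : ∀ {Z : Ω → E}, AEMeasurable Z P →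
        charFunDual (P.map Z) L = ∫ ω, Complex.exp (L (Z ω) * Complex.I) ∂P := fun hZ => by
      rw [charFunDual_apply, integral_map hZ]
      exact Continuous.aestronglyMeasurable (by fun_prop)
    simp_rw [this hY, fun n => this (hX n).aemeasurable]
    refine tendsto_integral_of_dominated_convergence (fun _ => 1) (fun n => ?_)
      (integrable_const _) (fun n => .of_forall fun ω => ?_) ?_
    · have := hmX n
      exact AEMeasurable.aestronglyMeasurable (by fun_prop)
    · rw [Complex.norm_exp_ofReal_mul_I]
    · filter_upwards [hLlim] with ω h
      exact ((by fun_prop : Continuous fun x : ℝ => Complex.exp (x * Complex.I)).tendsto _).comp h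
  have c2 : Filter.Tendsto (fun n => P[L ∘ X n]) Filter.atTop (nhds (P[L ∘ Y])) := by
    refine tendsto_integral_of_dominated_convergence (fun ω => 1 + ‖L‖ ^ 2 * Q ω)
      (fun n => (hmX n).aestronglyMeasurable) ((integrable_const _).add hQ2) (fun n => ?_) hLlim
    filter_upwards [hb n] with ω h
    have := hsq _ h
    simp only [Function.comp]
    nlinarith [sq_nonneg (‖L (X n ω)‖ - 1)]
  have c3 : Filter.Tendsto (fun n => P[(L ∘ X n) ^ 2]) Filter.atTop (nhds (P[(L ∘ Y) ^ 2])) := by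
    refine tendsto_integral_of_dominated_convergence (fun ω => ‖L‖ ^ 2 * Q ω)
      (fun n => ((hmX n).pow_const 2).aestronglyMeasurable) hQ2 (fun n => ?_) ?_
    · filter_upwards [hb n] with ω h
      simpa using hsq _ h
    · filter_upwards [hLlim] with ω h
      exact h.pow 2
  have hL2 : MemLp (L ∘ Y) 2 P := by
    refine (memLp_two_iff_integrable_sq_norm hmY.aestronglyMeasurable).2 ?_
    refine hQ2.mono' (hmY.norm.pow_const 2).aestronglyMeasurable ?_
    filter_upwards [hbY] with ω h
    simpa using hsq _ h
  have c4 : Filter.Tendsto (fun n => Var[L ∘ X n; P]) Filter.atTop (nhds (Var[L ∘ Y; P])) := by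
    simp_rw [variance_eq_sub hL2, fun n => variance_eq_sub ((hX n).map L).memLp_two]
    exact c3.sub (c2.pow 2)
  refine tendsto_nhds_unique c1 ?_
  simp_rw [fun n => (hX n).charFunDual_map_eq L]
  refine (Complex.continuous_exp.tendsto _).comp ?_
  exact (((Complex.continuous_ofReal.tendsto _).comp c2).mul_const _).sub
    (((Complex.continuous_ofReal.tendsto _).comp c4).div_const 2)

/-- A series of nonnegative functions with summable integrals converges almost everywhere to an
integrable function. -/
lemma ae_summable_and_integrable_tsum {f : ℕ → Ω → ℝ} (hf0 : ∀ k ω, 0 ≤ f k ω)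
    (hf : ∀ k, Integrable (f k) P) (hs : Summable fun k => ∫ ω, f k ω ∂P) :
    (∀ᵐ ω ∂P, Summable fun k => f k ω) ∧ Integrable (fun ω => ∑' k, f k ω) P := by
  have hm : ∀ k, AEMeasurable (fun ω => ENNReal.ofReal (f k ω)) P :=
    fun k => (hf k).aemeasurable.ennreal_ofReal
  have hfin : ∫⁻ ω, ∑' k, ENNReal.ofReal (f k ω) ∂P ≠ ∞ := by
    rw [lintegral_tsum hm]
    simp_rw [← fun k => ofReal_integral_eq_lintegral_ofReal (hf k) (.of_forall (hf0 k))]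
    exact hs.tsum_ofReal_ne_top
  have hmt : AEMeasurable (fun ω => ∑' k, ENNReal.ofReal (f k ω)) P := AEMeasurable.tsum hm
  have key : (fun ω => ∑' k, f k ω) = fun ω => (∑' k, ENNReal.ofReal (f k ω)).toReal := by
    ext ω
    rw [ENNReal.tsum_toReal_eq (fun k => ENNReal.ofReal_ne_top)]
    congr with k
    rw [ENNReal.toReal_ofReal (hf0 k ω)]
  refine ⟨?_, key ▸ integrable_toReal_of_lintegral_ne_top hmt hfin⟩
  filter_upwards [ae_lt_top' hmt hfin] with ω hω
  have := ENNReal.summable_toReal hω.ne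
  refine this.congr fun k => ?_
  rw [ENNReal.toReal_ofReal (hf0 k ω)]

end GaussianPairs

/-! ### Linear forms in the process and their isometry with `L²(F)`. -/

section LinearForms

variable {Ω : Type*} [MeasurableSpace Ω] {P : Measure Ω} {ξ : ℤ → Ω → ℂ} {γ : ℤ → ℂ}
  {F : Measure ℝ}

/-- The random linear form `∑_{k ≥ 0} u_k ξ_k`. -/
def linearForm (ξ : ℤ → Ω → ℂ) (u : ℕ → ℂ) (ω : Ω) : ℂ := ∑' k : ℕ, u k * ξ k ω

/-- The trigonometric series `∑_{k ≥ 0} u_k e^{-ikt}`. -/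
def symbol (u : ℕ → ℂ) (t : ℝ) : ℂ := ∑' k : ℕ, u k * Complex.exp (-Complex.I * (k : ℤ) * t)

lemma norm_exp_neg_I_mul (k : ℤ) (t : ℝ) : ‖Complex.exp (-Complex.I * k * t)‖ = 1 := by
  rw [show -Complex.I * k * t = ((-(k * t) : ℝ) : ℂ) * Complex.I by push_cast; ring,
    Complex.norm_exp_ofReal_mul_I]

lemma summable_symbol {u : ℕ → ℂ} (hu : Summable fun k => ‖u k‖) (t : ℝ) :
    Summable fun k : ℕ => u k * Complex.exp (-Complex.I * (k : ℤ) * t) := by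
  refine Summable.of_norm ?_
  simpa only [norm_mul, norm_exp_neg_I_mul, mul_one] using hu

namespace IsSpectralMeasure

lemma restrict_eq (hF : IsSpectralMeasure F γ) : F.restrict (Ioc (-π) π) = F :=
  Measure.restrict_eq_self_of_ae_mem (by rw [ae_iff]; exact hF.carried)

lemma covariance_eq (hF : IsSpectralMeasure F γ) (k : ℤ) :
    γ k = ∫ t, Complex.exp (-Complex.I * k * t) ∂F := by
  rw [hF.fourier k, hF.restrict_eq]

end IsSpectralMeasure

namespace IsStationaryComplexGaussian

lemma isProbabilityMeasure (hξ : IsStationaryComplexGaussian P ξ γ) : IsProbabilityMeasure P :=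
  hξ.gaussian.isProbabilityMeasure

lemma memLp_two (hξ : IsStationaryComplexGaussian P ξ γ) (k : ℤ) : MemLp (ξ k) 2 P :=
  (hξ.gaussian.hasGaussianLaw_eval k).memLp_two

lemma integral_norm_sq (hξ : IsStationaryComplexGaussian P ξ γ) (k : ℤ) :
    ∫ ω, ‖ξ k ω‖ ^ 2 ∂P = 1 := by
  have h := hξ.covariance k k
  rw [sub_self, hξ.normalized] at h
  have : ∀ ω, ξ k ω * conj (ξ k ω) = ((‖ξ k ω‖ ^ 2 : ℝ) : ℂ) := fun ω => by
    rw [Complex.mul_conj, Complex.normSq_eq_norm_sq]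
  simp_rw [this] at h
  rw [integral_complex_ofReal] at h
  exact_mod_cast h

lemma ae_summable_and_integrable (hξ : IsStationaryComplexGaussian P ξ γ) {u : ℕ → ℂ}
    (hu : Summable fun k => ‖u k‖) :
    (∀ᵐ ω ∂P, Summable fun k : ℕ => ‖u k‖ * ‖ξ k ω‖ ^ 2) ∧
      Integrable (fun ω => ∑' k : ℕ, ‖u k‖ * ‖ξ k ω‖ ^ 2) P := by
  refine ae_summable_and_integrable_tsum (fun k ω => by positivity)
    (fun k => (integrable_norm_sq (hξ.memLp_two k)).const_mul _) ?_
  simp_rw [integral_const_mul, hξ.integral_norm_sq, mul_one]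
  exact hu

lemma ae_summable_norm (hξ : IsStationaryComplexGaussian P ξ γ) {u : ℕ → ℂ}
    (hu : Summable fun k => ‖u k‖) : ∀ᵐ ω ∂P, Summable fun k : ℕ => ‖u k‖ * ‖ξ k ω‖ := by
  filter_upwards [(hξ.ae_summable_and_integrable hu).1] with ω hω
  refine Summable.of_nonneg_of_le (fun k => by positivity) (fun k => ?_) (hu.add hω)
  nlinarith [norm_nonneg (u k), sq_nonneg (‖ξ k ω‖ - 1), sq_nonneg (‖ξ k ω‖)]

/-- The partial sums of a linear form converge almost surely, dominated in mean square. -/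
lemma exists_dominating (hξ : IsStationaryComplexGaussian P ξ γ) {u : ℕ → ℂ}
    (hu : Summable fun k => ‖u k‖) :
    ∃ Q : Ω → ℝ, Integrable Q P ∧
      (∀ᵐ ω ∂P, ∀ n, ‖∑ k ∈ Finset.range n, u k * ξ k ω‖ ^ 2 ≤ Q ω) ∧
      ∀ᵐ ω ∂P, Filter.Tendsto (fun n => ∑ k ∈ Finset.range n, u k * ξ k ω) Filter.atTop
        (nhds (linearForm ξ u ω)) := by
  obtain ⟨h1, h2⟩ := hξ.ae_summable_and_integrable hu
  -- This bound is the Cauchy–Schwarz inequality with weights `‖u k‖`; it is integrable because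
  -- every `ξ k` has second moment `1`.
  refine ⟨fun ω => (∑' k, ‖u k‖) * ∑' k : ℕ, ‖u k‖ * ‖ξ k ω‖ ^ 2, h2.const_mul _, ?_, ?_⟩
  · filter_upwards [h1] with ω hω n
    calc ‖∑ k ∈ Finset.range n, u k * ξ k ω‖ ^ 2
        ≤ (∑ k ∈ Finset.range n, ‖u k‖ * ‖ξ k ω‖) ^ 2 := by
          gcongr
          refine (norm_sum_le _ _).trans_eq ?_
          simp_rw [norm_mul]
      _ ≤ (∑ k ∈ Finset.range n, ‖u k‖) * ∑ k ∈ Finset.range n, ‖u k‖ * ‖ξ k ω‖ ^ 2 := by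
          refine Finset.sum_sq_le_sum_mul_sum_of_sq_le_mul _ (fun i _ => by positivity)
            (fun i _ => by positivity) fun i _ => ?_
          exact le_of_eq (by ring)
      _ ≤ _ := by
          gcongr
          · exact hu.sum_le_tsum _ fun k _ => norm_nonneg _
          · exact hω.sum_le_tsum _ fun k _ => by positivity
  · filter_upwards [hξ.ae_summable_norm hu] with ω hω
    refine (Summable.of_norm ?_).hasSum.tendsto_sum_nat
    simpa only [norm_mul] using hω

/-- Pairs of partial sums are real-linear images of finitely many `ξ k`, and the dominating
functions permit the passage to the limit. -/
lemma hasGaussianLaw_pair (hξ : IsStationaryComplexGaussian P ξ γ) {u v : ℕ → ℂ}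
    (hu : Summable fun k => ‖u k‖) (hv : Summable fun k => ‖v k‖) :
    HasGaussianLaw (fun ω => (linearForm ξ u ω, linearForm ξ v ω)) P := by
  obtain ⟨Q, hQ, hQb, hQl⟩ := hξ.exists_dominating hu
  obtain ⟨R, hR, hRb, hRl⟩ := hξ.exists_dominating hv
  refine hasGaussianLaw_of_tendsto (X := fun n ω => (∑ k ∈ Finset.range n, u k * ξ k ω,
    ∑ k ∈ Finset.range n, v k * ξ k ω)) (fun n => ?_) (hQ.add hR) (fun n => ?_) ?_
  · let I : Finset ℤ := (Finset.range n).image (fun k : ℕ => (k : ℤ))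
    have hI : ∀ k : Fin n, ((k : ℕ) : ℤ) ∈ I := fun k =>
      Finset.mem_image_of_mem _ (Finset.mem_range.2 k.2)
    let S (u : ℕ → ℂ) : (I → ℂ) →L[ℝ] ℂ := ∑ k : Fin n, (ContinuousLinearMap.mul ℝ ℂ (u k)).comp
        (ContinuousLinearMap.proj (R := ℝ) (φ := fun _ : I => ℂ) ⟨((k : ℕ) : ℤ), hI k⟩)
    have h := (hξ.gaussian.hasGaussianLaw I).map_fun ((S u).prod (S v))
    have hS : ∀ u ω, S u (I.restrict (ξ · ω)) = ∑ k ∈ Finset.range n, u k * ξ k ω := fun u ω => by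
      simp only [S, sum_apply, ContinuousLinearMap.comp_apply,
        ContinuousLinearMap.proj_apply, ContinuousLinearMap.mul_apply', Finset.restrict]
      exact Fin.sum_univ_eq_sum_range (fun k => u k * ξ k ω) n
    refine h.congr (.of_forall fun ω => ?_)
    simp only [ContinuousLinearMap.prod_apply, hS]
  · filter_upwards [hQb, hRb] with ω h1 h2
    have h1 := h1 n
    have h2 := h2 n
    rw [Prod.norm_def]
    simp only [Pi.add_apply]
    rcases max_choice ‖∑ k ∈ Finset.range n, u k * ξ k ω‖ ‖∑ k ∈ Finset.range n, v k * ξ k ω‖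
      with h | h <;> rw [h] <;>
      nlinarith [sq_nonneg ‖∑ k ∈ Finset.range n, u k * ξ k ω‖,
        sq_nonneg ‖∑ k ∈ Finset.range n, v k * ξ k ω‖]
  · filter_upwards [hQl, hRl] with ω h1 h2
    exact h1.prodMk_nhds h2

lemma memLp_linearForm (hξ : IsStationaryComplexGaussian P ξ γ) {u : ℕ → ℂ}
    (hu : Summable fun k => ‖u k‖) : MemLp (linearForm ξ u) 2 P :=
  (hξ.hasGaussianLaw_pair hu hu).fst.memLp_two

lemma integral_linearForm (hξ : IsStationaryComplexGaussian P ξ γ) {u : ℕ → ℂ}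
    (hu : Summable fun k => ‖u k‖) : ∫ ω, linearForm ξ u ω ∂P = 0 := by
  have := hξ.isProbabilityMeasure
  obtain ⟨Q, hQ, hQb, hQl⟩ := hξ.exists_dominating hu
  have hi : ∀ k : ℕ, Integrable (fun ω => u k * ξ k ω) P := fun k =>
    ((hξ.memLp_two k).integrable (by norm_num)).const_mul _
  have h := tendsto_integral_of_dominated_convergence (fun ω => 1 + Q ω)
    (fun n => (integrable_finsetSum (Finset.range n) fun k _ => hi k).aestronglyMeasurable)
    ((integrable_const _).add hQ) (fun n => ?_) hQl
  · refine tendsto_nhds_unique h ?_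
    have : ∀ n, ∫ ω, ∑ k ∈ Finset.range n, u k * ξ k ω ∂P = 0 := fun n => by
      rw [integral_finsetSum _ fun k _ => hi k]
      exact Finset.sum_eq_zero fun k _ => by rw [integral_const_mul, hξ.centered, mul_zero]
    simp_rw [this]
    exact tendsto_const_nhds
  · filter_upwards [hQb] with ω hω
    nlinarith [hω n, sq_nonneg (‖∑ k ∈ Finset.range n, u k * ξ k ω‖ - 1)]

/-- The map `c` is the identity for pseudo-covariances and conjugation for covariances. -/
lemma tendsto_integral_mul (hξ : IsStationaryComplexGaussian P ξ γ) {u v : ℕ → ℂ}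
    (hu : Summable fun k => ‖u k‖) (hv : Summable fun k => ‖v k‖) {c : ℂ → ℂ}
    (hc : Continuous c) (hcn : ∀ z, ‖c z‖ = ‖z‖) :
    Filter.Tendsto (fun n => ∫ ω, (∑ k ∈ Finset.range n, u k * ξ k ω) *
      c (∑ k ∈ Finset.range n, v k * ξ k ω) ∂P) Filter.atTop
      (nhds (∫ ω, linearForm ξ u ω * c (linearForm ξ v ω) ∂P)) := by
  obtain ⟨Q, hQ, hQb, hQl⟩ := hξ.exists_dominating hu
  obtain ⟨R, hR, hRb, hRl⟩ := hξ.exists_dominating hv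
  have := hξ.isProbabilityMeasure
  have hm : ∀ (u : ℕ → ℂ) n, AEStronglyMeasurable
      (fun ω => ∑ k ∈ Finset.range n, u k * ξ k ω) P := fun u n =>
    (integrable_finsetSum (Finset.range n) fun k _ =>
      ((hξ.memLp_two k).integrable (by norm_num)).const_mul _).aestronglyMeasurable
  refine tendsto_integral_of_dominated_convergence (fun ω => Q ω + R ω)
    (fun n => (hm u n).mul (hc.comp_aestronglyMeasurable (hm v n))) (hQ.add hR) (fun n => ?_) ?_
  · filter_upwards [hQb, hRb] with ω h1 h2
    rw [norm_mul, hcn]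
    nlinarith [h1 n, h2 n, sq_nonneg (‖∑ k ∈ Finset.range n, u k * ξ k ω‖ -
      ‖∑ k ∈ Finset.range n, v k * ξ k ω‖), sq_nonneg ‖∑ k ∈ Finset.range n, u k * ξ k ω‖,
      sq_nonneg ‖∑ k ∈ Finset.range n, v k * ξ k ω‖]
  · filter_upwards [hQl, hRl] with ω h1 h2
    exact h1.mul ((hc.tendsto _).comp h2)

lemma integral_linearForm_mul (hξ : IsStationaryComplexGaussian P ξ γ) {u v : ℕ → ℂ}
    (hu : Summable fun k => ‖u k‖) (hv : Summable fun k => ‖v k‖) :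
    ∫ ω, linearForm ξ u ω * linearForm ξ v ω ∂P = 0 := by
  refine tendsto_nhds_unique (hξ.tendsto_integral_mul hu hv continuous_id fun _ => rfl) ?_
  have : ∀ n, ∫ ω, (∑ k ∈ Finset.range n, u k * ξ k ω) *
      id (∑ k ∈ Finset.range n, v k * ξ k ω) ∂P = 0 := fun n => by
    have hi : ∀ k l : ℕ, Integrable (fun ω => u k * ξ k ω * (v l * ξ l ω)) P := fun k l =>
      ((hξ.memLp_two k).const_mul (u k)).integrable_mul ((hξ.memLp_two l).const_mul (v l))
    simp_rw [id, Finset.sum_mul_sum]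
    rw [integral_finsetSum _ fun k _ => integrable_finsetSum _ fun l _ => hi k l]
    refine Finset.sum_eq_zero fun k _ => ?_
    rw [integral_finsetSum _ fun l _ => hi k l]
    refine Finset.sum_eq_zero fun l _ => ?_
    simp_rw [mul_mul_mul_comm (u k)]
    rw [integral_const_mul, hξ.circular, mul_zero]
  simp_rw [this]
  exact tendsto_const_nhds

/-- The isometry between linear forms in `ξ` and trigonometric series in `L²(F)`. -/
lemma integral_linearForm_mul_conj (hξ : IsStationaryComplexGaussian P ξ γ)
    (hF : IsSpectralMeasure F γ) {u v : ℕ → ℂ}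
    (hu : Summable fun k => ‖u k‖) (hv : Summable fun k => ‖v k‖) :
    ∫ ω, linearForm ξ u ω * conj (linearForm ξ v ω) ∂P =
      ∫ t, symbol u t * conj (symbol v t) ∂F := by
  have := hF.isProbabilityMeasure
  refine tendsto_nhds_unique (hξ.tendsto_integral_mul hu hv Complex.continuous_conj (by simp)) ?_
  let e (k : ℕ) (t : ℝ) : ℂ := Complex.exp (-Complex.I * (k : ℤ) * t)
  have he : ∀ k, Continuous (e k) := fun k => by fun_prop
  have key : ∀ n, ∫ ω, (∑ k ∈ Finset.range n, u k * ξ k ω) *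
      conj (∑ k ∈ Finset.range n, v k * ξ k ω) ∂P =
      ∫ t, (∑ k ∈ Finset.range n, u k * e k t) * conj (∑ k ∈ Finset.range n, v k * e k t) ∂F := by
    intro n
    have hi : ∀ k l : ℕ, Integrable (fun ω => u k * ξ k ω * conj (v l * ξ l ω)) P := fun k l =>
      ((hξ.memLp_two k).const_mul (u k)).integrable_mul
        (memLp_conj ((hξ.memLp_two l).const_mul (v l)))
    have hj : ∀ k l : ℕ, Integrable (fun t => u k * e k t * conj (v l * e l t)) F := fun k l => by
      refine Integrable.of_bound (C := ‖u k‖ * ‖v l‖) ?_ (.of_forall fun t => ?_)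
      · exact Continuous.aestronglyMeasurable (by fun_prop)
      · rw [norm_mul, RCLike.norm_conj, norm_mul, norm_mul]
        simp only [e, norm_exp_neg_I_mul, mul_one, le_refl]
    simp_rw [map_sum, Finset.sum_mul_sum]
    rw [integral_finsetSum _ fun k _ => integrable_finsetSum _ fun l _ => hi k l,
      integral_finsetSum _ fun k _ => integrable_finsetSum _ fun l _ => hj k l]
    refine Finset.sum_congr rfl fun k _ => ?_
    rw [integral_finsetSum _ fun l _ => hi k l, integral_finsetSum _ fun l _ => hj k l]
    refine Finset.sum_congr rfl fun l _ => ?_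
    have hr : ∀ x y : ℂ, u k * x * conj (v l * y) = u k * conj (v l) * (x * conj y) :=
      fun x y => by rw [map_mul, mul_mul_mul_comm]
    simp only [hr]
    rw [integral_const_mul, integral_const_mul, hξ.covariance, hF.covariance_eq]
    congr 2 with t
    simp only [e]
    rw [← Complex.exp_conj, ← Complex.exp_add]
    congr 1
    simp
    ring
  simp_rw [key]
  have hb : ∀ {u : ℕ → ℂ} (hu : Summable fun k => ‖u k‖) (n : ℕ) (t : ℝ),
      ‖∑ k ∈ Finset.range n, u k * e k t‖ ≤ ∑' k, ‖u k‖ := fun {u} hu n t => by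
    refine (norm_sum_le _ _).trans ?_
    simp only [norm_mul, e, norm_exp_neg_I_mul, mul_one]
    exact hu.sum_le_tsum _ fun k _ => norm_nonneg _
  refine tendsto_integral_of_dominated_convergence
    (fun _ => (∑' k, ‖u k‖) * ∑' k, ‖v k‖) (fun n => ?_) (integrable_const _)
    (fun n => .of_forall fun t => ?_) (.of_forall fun t => ?_)
  · exact Continuous.aestronglyMeasurable (by fun_prop)
  · rw [norm_mul, RCLike.norm_conj]
    exact mul_le_mul (hb hu n t) (hb hv n t) (norm_nonneg _) (tsum_nonneg fun k => norm_nonneg _)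
  · exact (summable_symbol hu t).hasSum.tendsto_sum_nat.mul
      ((Complex.continuous_conj.tendsto _).comp (summable_symbol hv t).hasSum.tendsto_sum_nat)

lemma integral_norm_sq_linearForm (hξ : IsStationaryComplexGaussian P ξ γ)
    (hF : IsSpectralMeasure F γ) {u : ℕ → ℂ} (hu : Summable fun k => ‖u k‖) :
    ∫ ω, ‖linearForm ξ u ω‖ ^ 2 ∂P = ∫ t, ‖symbol u t‖ ^ 2 ∂F := by
  have h := hξ.integral_linearForm_mul_conj hF hu hu
  simp_rw [Complex.mul_conj, Complex.normSq_eq_norm_sq] at h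
  rw [integral_complex_ofReal, integral_complex_ofReal] at h
  exact_mod_cast h

lemma integral_exp_neg_norm_sq_linearForm (hξ : IsStationaryComplexGaussian P ξ γ)
    (hF : IsSpectralMeasure F γ) {u v : ℕ → ℂ}
    (hu : Summable fun k => ‖u k‖) (hv : Summable fun k => ‖v k‖) :
    ∫ ω, Real.exp (-‖linearForm ξ u ω‖ ^ 2) * ‖linearForm ξ v ω‖ ^ 2 ∂P =
      ((∫ t, ‖symbol v t‖ ^ 2 ∂F) * (1 + ∫ t, ‖symbol u t‖ ^ 2 ∂F) -
        ‖∫ t, symbol v t * conj (symbol u t) ∂F‖ ^ 2) / (1 + ∫ t, ‖symbol u t‖ ^ 2 ∂F) ^ 2 := by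
  rw [integral_exp_neg_norm_sq_mul_norm_sq (hξ.hasGaussianLaw_pair hu hv)
    (hξ.integral_linearForm hu) (hξ.integral_linearForm hv) (hξ.integral_linearForm_mul hu hu)
    (hξ.integral_linearForm_mul hu hv), hξ.integral_norm_sq_linearForm hF hu,
    hξ.integral_norm_sq_linearForm hF hv, hξ.integral_linearForm_mul_conj hF hv hu]

end IsStationaryComplexGaussian

end LinearForms

/-! ### Counting points of a set. -/

section PointMeasure

/-- The point measure `∑_{z ∈ Z} δ_z`. -/
def pointMeasure (Z : Set ℂ) : Measure ℂ := Measure.sum fun z : Z => Measure.dirac (z : ℂ)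

lemma pointMeasure_apply (Z : Set ℂ) {A : Set ℂ} (hA : MeasurableSet A) :
    pointMeasure Z A = ∑' z : Z, A.indicator 1 (z : ℂ) := by
  rw [pointMeasure, Measure.sum_apply _ hA]
  simp_rw [Measure.dirac_apply' _ hA]

lemma pointMeasure_eq_zero {Z A : Set ℂ} (hA : MeasurableSet A) (h : ∀ z ∈ Z, z ∉ A) :
    pointMeasure Z A = 0 := by
  rw [pointMeasure_apply Z hA]
  exact ENNReal.tsum_eq_zero.2 fun z => indicator_of_notMem (h z z.2) _

lemma one_le_pointMeasure {Z A : Set ℂ} (hA : MeasurableSet A) {z : ℂ} (hz : z ∈ Z) (hzA : z ∈ A) :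
    1 ≤ pointMeasure Z A := by
  rw [pointMeasure_apply Z hA]
  refine le_trans ?_ (ENNReal.le_tsum (⟨z, hz⟩ : Z))
  simp [hzA]

lemma pointMeasure_eq_one {Z A : Set ℂ} (hA : MeasurableSet A) {z : ℂ} (hz : z ∈ Z) (hzA : z ∈ A)
    (h : ∀ y ∈ Z, y ∈ A → y = z) : pointMeasure Z A = 1 := by
  rw [pointMeasure_apply Z hA, tsum_eq_single (⟨z, hz⟩ : Z)]
  · simp [hzA]
  · intro y hy
    exact indicator_of_notMem (fun hyA => hy (Subtype.ext (h y y.2 hyA))) _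

lemma pointMeasure_fiber_of_injOn {g : ℂ → ℂ} {D B : Set ℂ} (hB : MeasurableSet B) (hBD : B ⊆ D)
    (hg : InjOn g B) (w : ℂ) :
    pointMeasure {z | z ∈ D ∧ g z = w} B = (g '' B).indicator 1 w := by
  by_cases hw : w ∈ g '' B
  · obtain ⟨z, hz, rfl⟩ := hw
    rw [indicator_of_mem (mem_image_of_mem g hz)]
    exact pointMeasure_eq_one hB ⟨hBD hz, rfl⟩ hz fun y hy hyB => hg hyB hz hy.2
  · rw [indicator_of_notMem hw]
    exact pointMeasure_eq_zero hB fun z hz hzB => hw ⟨z, hzB, hz.2⟩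

end PointMeasure

/-! ### The area formula for holomorphic maps. -/

section AreaFormula

lemma det_smulRight_restrictScalars (c : ℂ) :
    ((ContinuousLinearMap.toSpanSingleton ℂ c).restrictScalars ℝ).det = ‖c‖ ^ 2 := by
  have h : (((ContinuousLinearMap.toSpanSingleton ℂ c).restrictScalars ℝ : ℂ →L[ℝ] ℂ) :
      ℂ →ₗ[ℝ] ℂ) = ((LinearMap.toSpanSingleton ℂ ℂ c).restrictScalars ℝ) := rfl
  rw [ContinuousLinearMap.det, h, LinearMap.det_restrictScalars]
  simp [Algebra.norm_complex_apply, Complex.normSq_eq_norm_sq]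

lemma exists_isOpen_injOn {g : ℂ → ℂ} {D : Set ℂ} (hD : IsOpen D) (hg : DifferentiableOn ℂ g D)
    {z : ℂ} (hz : z ∈ D) (hz' : deriv g z ≠ 0) : ∃ U, IsOpen U ∧ z ∈ U ∧ InjOn g U := by
  have h := ((hg.analyticOnNhd hD) z hz).hasStrictDerivAt.hasStrictFDerivAt_equiv hz'
  exact ⟨(h.toOpenPartialHomeomorph g).source, (h.toOpenPartialHomeomorph g).open_source,
    h.mem_toOpenPartialHomeomorph_source, (h.toOpenPartialHomeomorph g).injOn⟩

/-- The inverse function theorem gives injectivity near each noncritical point, and the Lindelöf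
property makes the cover countable. -/
lemma exists_countable_cover_injOn {g : ℂ → ℂ} {D : Set ℂ} (hD : IsOpen D)
    (hg : DifferentiableOn ℂ g D) :
    ∃ U : ℕ → Set ℂ, (∀ n, IsOpen (U n)) ∧ (∀ n, InjOn g (U n)) ∧
      {z | z ∈ D ∧ deriv g z ≠ 0} ⊆ ⋃ n, U n := by
  have h : ∀ z, ∃ U, IsOpen U ∧ InjOn g U ∧ (z ∈ D ∧ deriv g z ≠ 0 → z ∈ U) := fun z => by
    by_cases hz : z ∈ D ∧ deriv g z ≠ 0
    · obtain ⟨U, h1, h2, h3⟩ := exists_isOpen_injOn hD hg hz.1 hz.2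
      exact ⟨U, h1, h3, fun _ => h2⟩
    · exact ⟨∅, isOpen_empty, by simp, fun h => absurd h hz⟩
  choose U hU hUi hUm using h
  obtain ⟨t, -, htc, ht⟩ := TopologicalSpace.countable_cover_nhdsWithin
    (s := {z | z ∈ D ∧ deriv g z ≠ 0}) (f := U)
    fun z hz => mem_nhdsWithin_of_mem_nhds ((hU z).mem_nhds (hUm z hz))
  rcases t.eq_empty_or_nonempty with rfl | hne
  · exact ⟨fun _ => ∅, by simp, by simp, by simpa using ht⟩
  · obtain ⟨e, rfl⟩ := htc.exists_eq_range hne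
    exact ⟨fun n => U (e n), fun n => hU _, fun n => hUi _, by simpa using ht⟩

/-- The area formula for a holomorphic map, with the fibers counted without multiplicity. -/
theorem lintegral_mul_pointMeasure_fiber {g : ℂ → ℂ} {D A : Set ℂ} (hD : IsOpen D)
    (hg : DifferentiableOn ℂ g D) (hAD : A ⊆ D) (hA : MeasurableSet A) {p : ℂ → ℝ≥0∞}
    (hp : Measurable p) :
    ∫⁻ w, p w * pointMeasure {z | z ∈ D ∧ g z = w} A =
      ∫⁻ z in A, p (g z) * ENNReal.ofReal (‖deriv g z‖ ^ 2) := by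
  obtain ⟨U, hU, hUi, hUc⟩ := exists_countable_cover_injOn hD hg
  let f' : ℂ → ℂ →L[ℝ] ℂ := fun z =>
    (ContinuousLinearMap.toSpanSingleton ℂ (deriv g z)).restrictScalars ℝ
  have hdet : ∀ z, (f' z).det = ‖deriv g z‖ ^ 2 := fun z => det_smulRight_restrictScalars _
  have hf' : ∀ {s : Set ℂ}, s ⊆ D → ∀ z ∈ s, HasFDerivWithinAt g (f' z) s z := fun hs z hz =>
    (((hg.differentiableAt (hD.mem_nhds (hs hz))).hasDerivAt.hasFDerivAt).restrictScalars
      ℝ).hasFDerivWithinAt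
  have hmd : MeasurableSet {z | deriv g z = 0} := measurable_deriv g (measurableSet_singleton 0)
  -- The critical points `C` contribute to neither side. The rest of `A` is cut into countably many
  -- disjoint pieces on which `g` is injective, where the change of variables formula applies.
  set C := A ∩ {z | deriv g z = 0} with hC
  set B : ℕ → Set ℂ := fun n => (A ∩ {z | deriv g z = 0}ᶜ) ∩ disjointed U n with hB
  have hCm : MeasurableSet C := hA.inter hmd
  have hBm : ∀ n, MeasurableSet (B n) := fun n =>
    (hA.inter hmd.compl).inter (MeasurableSet.disjointed (fun n => (hU n).measurableSet) n)
  have hBD : ∀ n, B n ⊆ D := fun n z hz => hAD hz.1.1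
  have hBi : ∀ n, InjOn g (B n) := fun n =>
    (hUi n).mono fun z hz => disjointed_subset U n hz.2
  have hBd : Pairwise (Function.onFun Disjoint B) := fun m n hmn =>
    (disjoint_disjointed U hmn).mono inter_subset_right inter_subset_right
  have hAe : A = C ∪ ⋃ n, B n := by
    rw [hB, ← inter_iUnion, iUnion_disjointed, hC]
    ext z
    constructor
    · intro hz
      by_cases h : deriv g z = 0
      · exact Or.inl ⟨hz, h⟩
      · exact Or.inr ⟨⟨hz, h⟩, hUc ⟨hAD hz, h⟩⟩
    · rintro (h | h)
      · exact h.1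
      · exact h.1.1
  have hCB : Disjoint C (⋃ n, B n) := disjoint_iUnion_right.2 fun n =>
    disjoint_left.2 fun z hz hz' => hz'.1.2 hz.2
  -- Sard's theorem: almost no level `w` is attained at a critical point.
  have hCnull : volume (g '' C) = 0 :=
    addHaar_image_eq_zero_of_det_fderivWithin_eq_zero volume (hf' (fun z hz => hAD hz.1))
      fun z hz => by rw [hdet, show deriv g z = 0 from hz.2]; simp
  have hleft : ∀ᵐ w, p w * pointMeasure {z | z ∈ D ∧ g z = w} A =
      ∑' n, (g '' B n).indicator p w := by
    filter_upwards [measure_eq_zero_iff_ae_notMem.1 hCnull] with w hw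
    rw [hAe, measure_union hCB (MeasurableSet.iUnion hBm), measure_iUnion hBd hBm,
      pointMeasure_eq_zero hCm fun z hz hzC => hw ⟨z, hzC, hz.2⟩, zero_add, ← ENNReal.tsum_mul_left]
    congr with n
    rw [pointMeasure_fiber_of_injOn (hBm n) (hBD n) (hBi n)]
    by_cases h : w ∈ g '' B n <;> simp [h]
  have him : ∀ n, MeasurableSet (g '' B n) := fun n =>
    measurable_image_of_fderivWithin (hBm n) (hf' (hBD n)) (hBi n)
  rw [lintegral_congr_ae hleft, lintegral_tsum fun n => (hp.indicator (him n)).aemeasurable]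
  have hCzero : ∫⁻ z in C, p (g z) * ENNReal.ofReal (‖deriv g z‖ ^ 2) = 0 := by
    rw [setLIntegral_congr_fun (g := fun _ => 0) hCm fun z hz => by
      simp [show deriv g z = 0 from hz.2]]
    simp
  conv_rhs => rw [hAe]
  rw [lintegral_union (MeasurableSet.iUnion hBm) hCB, hCzero, zero_add,
    lintegral_iUnion hBm hBd]
  congr with n
  rw [lintegral_indicator (him n), lintegral_image_eq_lintegral_abs_det_fderiv_mul volume (hBm n)
    (hf' (hBD n)) (hBi n)]
  congr with z
  rw [hdet, abs_of_nonneg (by positivity), mul_comm]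

end AreaFormula

/-! ### Measurability of the number of zeros. -/

section CountMeasurability

variable {S : Type*} [MeasurableSpace S]

/-- On a compact set `|f s|` attains its minimum, so a zero exists exactly when `|f s|` takes
arbitrarily small values on a countable dense subset. -/
lemma measurableSet_exists_zero {f : S → ℂ → ℂ} {K : Set ℂ} (hK : IsCompact K)
    (hfm : ∀ z ∈ K, Measurable fun s => f s z) (hfc : ∀ s, ContinuousOn (f s) K) :
    MeasurableSet {s | ∃ z ∈ K, f s z = 0} := by
  obtain ⟨Q, hQK, hQc, hQ⟩ := (hK.isSeparable).exists_countable_dense_subset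
  have key : {s | ∃ z ∈ K, f s z = 0} =
      ⋂ n : ℕ, ⋃ q ∈ Q, {s | ‖f s q‖ < 1 / ((n : ℝ) + 1)} := by
    ext s
    simp only [mem_ofPred_eq, mem_iInter, mem_iUnion, exists_prop]
    constructor
    · rintro ⟨z, hz, hz0⟩ n
      have h1 : Filter.Tendsto (fun y => ‖f s y‖) (nhdsWithin z Q) (nhds 0) := by
        have := ((hfc s z hz).mono hQK).norm.tendsto
        rwa [hz0, norm_zero] at this
      have : (nhdsWithin z Q).NeBot := mem_closure_iff_nhdsWithin_neBot.1 (hQ hz)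
      obtain ⟨q, hq1, hq2⟩ := ((h1.eventually_lt_const (u := 1 / ((n : ℝ) + 1)) (by positivity)).and
        self_mem_nhdsWithin).exists
      exact ⟨q, hq2, hq1⟩
    · intro h
      obtain ⟨q, hq, -⟩ := h 0
      obtain ⟨z, hz, hmin⟩ := hK.exists_isMinOn ⟨q, hQK hq⟩ (hfc s).norm
      refine ⟨z, hz, ?_⟩
      by_contra hne
      obtain ⟨n, hn⟩ := exists_nat_one_div_lt (norm_pos_iff.2 hne)
      obtain ⟨y, hy, hy'⟩ := h n
      exact absurd (hmin (hQK hy)) (not_le.2 (hy'.trans hn))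
  rw [key]
  refine MeasurableSet.iInter fun n => MeasurableSet.biUnion hQc fun q hq => ?_
  exact measurableSet_lt (hfm q (hQK hq)).norm measurable_const

/-- A countable family of closed balls containing a basis of neighborhoods of every point. -/
def denseBall (i : ℕ × ℕ) : Set ℂ :=
  Metric.closedBall (TopologicalSpace.denseSeq ℂ i.1) (1 / ((i.2 : ℝ) + 1))

lemma exists_denseBall {z : ℂ} {U : Set ℂ} (hU : IsOpen U) (hz : z ∈ U) :
    ∃ i, z ∈ denseBall i ∧ denseBall i ⊆ U := by
  obtain ⟨ε, hε, hεU⟩ := Metric.isOpen_iff.1 hU z hz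
  obtain ⟨n, hn⟩ := exists_nat_one_div_lt (half_pos hε)
  obtain ⟨k, hk⟩ := (TopologicalSpace.denseRange_denseSeq ℂ).exists_dist_lt z
    (show (0 : ℝ) < 1 / ((n : ℝ) + 1) by positivity)
  refine ⟨(k, n), Metric.mem_closedBall.2 hk.le, fun y hy => hεU ?_⟩
  have h1 := Metric.mem_closedBall.1 hy
  have h2 := dist_triangle_right y z (TopologicalSpace.denseSeq ℂ k)
  simp only at h1
  rw [Metric.mem_ball]
  linarith

/-- Finite families of pairwise disjoint balls. -/
abbrev DisjointBalls : Type :=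
  {T : Finset (ℕ × ℕ) // (T : Set (ℕ × ℕ)).PairwiseDisjoint denseBall}

open scoped Classical in
-- Finitely many distinct points can be isolated in disjoint balls of the countable family, and
-- disjoint balls never overcount. The count thus becomes a countable supremum of sums of hitting
-- indicators, each measurable once `K` is compact.
lemma pointMeasure_eq_iSup (Z : Set ℂ) {K : Set ℂ} (hK : MeasurableSet K) :
    pointMeasure Z K =
      ⨆ T : DisjointBalls, ∑ i ∈ T.1, if ∃ z ∈ K ∩ denseBall i, z ∈ Z then 1 else 0 := by
  have hb : ∀ i, MeasurableSet (denseBall i) := fun i => Metric.isClosed_closedBall.measurableSet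
  apply le_antisymm
  · rw [pointMeasure_apply Z hK, ENNReal.tsum_eq_iSup_sum]
    refine iSup_le fun T => ?_
    set T' : Finset Z := T.filter fun z : Z => (z : ℂ) ∈ K with hT'
    have h1 : ∑ z ∈ T, K.indicator (1 : ℂ → ℝ≥0∞) (z : ℂ) = ∑ z ∈ T', (1 : ℝ≥0∞) := by
      rw [hT', Finset.sum_filter]
      refine Finset.sum_congr rfl fun z _ => ?_
      simp [indicator_apply]
    obtain ⟨U, hU, hUd⟩ := (T'.finite_toSet.image Subtype.val).t2_separation
    choose e he he' using fun z : Z => exists_denseBall (hU z).2 (hU z).1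
    have hdis : ∀ z ∈ T', ∀ y ∈ T', z ≠ y → Disjoint (denseBall (e z)) (denseBall (e y)) :=
      fun z hz y hy hzy => (hUd (mem_image_of_mem _ hz) (mem_image_of_mem _ hy)
        fun h => hzy (Subtype.ext h)).mono (he' z) (he' y)
    have hinj : InjOn e T' := fun z hz y hy hzy => by
      by_contra hne
      have := hdis z hz y hy hne
      rw [← hzy, disjoint_self] at this
      have hz' := he z
      rw [this] at hz'
      exact hz'
    let T'' : DisjointBalls := ⟨T'.image e, by
      intro i hi j hj hij
      obtain ⟨z, hz, rfl⟩ := Finset.mem_image.1 (Finset.mem_coe.1 hi)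
      obtain ⟨y, hy, rfl⟩ := Finset.mem_image.1 (Finset.mem_coe.1 hj)
      exact hdis z hz y hy fun h => hij (by rw [h])⟩
    rw [h1]
    refine le_iSup_of_le T'' ?_
    simp only [T'']
    rw [Finset.sum_image hinj]
    refine Finset.sum_le_sum fun z hz => ?_
    rw [if_pos ⟨z, ⟨(Finset.mem_filter.1 hz).2, he z⟩, z.2⟩]
  · refine iSup_le fun T => ?_
    calc ∑ i ∈ T.1, (if ∃ z ∈ K ∩ denseBall i, z ∈ Z then 1 else 0)
        ≤ ∑ i ∈ T.1, pointMeasure Z (K ∩ denseBall i) := by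
          refine Finset.sum_le_sum fun i _ => ?_
          split_ifs with h
          · obtain ⟨z, hz, hzZ⟩ := h
            exact one_le_pointMeasure (hK.inter (hb i)) hzZ hz
          · exact zero_le
      _ = pointMeasure Z (⋃ i ∈ T.1, K ∩ denseBall i) :=
          (measure_biUnion_finset (fun i hi j hj hij =>
            (T.2 hi hj hij).mono inter_subset_right inter_subset_right)
            fun i _ => hK.inter (hb i)).symm
      _ ≤ pointMeasure Z K := measure_mono (iUnion₂_subset fun i _ => inter_subset_left)

/-- The number of zeros in a Borel set of a measurable family of continuous functions with finitely
many zeros in every compact set is measurable. -/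
theorem measurable_pointMeasure_zeros {f : S → ℂ → ℂ}
    (hfm : ∀ z ∈ unitDisk, Measurable fun s => f s z) (hfc : ∀ s, ContinuousOn (f s) unitDisk)
    (hfin : ∀ s, ∀ r < 1, {z | ‖z‖ ≤ r ∧ f s z = 0}.Finite) {A : Set ℂ} (hA : MeasurableSet A)
    (hAD : A ⊆ unitDisk) :
    Measurable fun s => pointMeasure {z | z ∈ unitDisk ∧ f s z = 0} A := by
  classical
  let Z : S → Set ℂ := fun s => {z | z ∈ unitDisk ∧ f s z = 0}
  have hball : ∀ r : ℝ, MeasurableSet (Metric.closedBall (0 : ℂ) r) :=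
    fun r => Metric.isClosed_closedBall.measurableSet
  have hsub : ∀ r < 1, Metric.closedBall (0 : ℂ) r ⊆ unitDisk := fun r hr z hz =>
    lt_of_le_of_lt (mem_closedBall_zero_iff.1 hz) hr
  have hcompact : ∀ K : Set ℂ, IsCompact K → K ⊆ unitDisk →
      Measurable fun s => pointMeasure (Z s) K := fun K hK hKD => by
    simp_rw [pointMeasure_eq_iSup _ hK.measurableSet]
    refine Measurable.iSup fun T => Finset.measurable_sum _ fun i _ => ?_
    have hKi : IsCompact (K ∩ denseBall i) := hK.inter_right Metric.isClosed_closedBall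
    have hKiD : K ∩ denseBall i ⊆ unitDisk := inter_subset_left.trans hKD
    refine Measurable.ite ?_ measurable_const measurable_const
    have := measurableSet_exists_zero hKi (fun z hz => hfm z (hKiD hz)) fun s => (hfc s).mono hKiD
    convert! this using 1
    ext s
    exact exists_congr fun z => and_congr_right fun hz => ⟨fun h => h.2, fun h => ⟨hKiD hz, h⟩⟩
  have hr : ∀ r < 1, Measurable fun s => (pointMeasure (Z s)).restrict (Metric.closedBall 0 r) := by
    intro r hr
    have : ∀ s, IsFiniteMeasure ((pointMeasure (Z s)).restrict (Metric.closedBall 0 r)) := fun s => by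
      refine ⟨?_⟩
      rw [Measure.restrict_apply_univ, pointMeasure_apply _ (hball r)]
      have hf : (Function.support fun z : Z s =>
          (Metric.closedBall (0 : ℂ) r).indicator (1 : ℂ → ℝ≥0∞) z).Finite := by
        refine Set.Finite.of_finite_image ((hfin s r hr).subset ?_) Subtype.val_injective.injOn
        rintro _ ⟨z, hz, rfl⟩
        exact ⟨mem_closedBall_zero_iff.1 (mem_of_indicator_ne_zero hz), z.2.2⟩
      rw [tsum_eq_sum (s := hf.toFinset) (by simp)]
      refine ENNReal.sum_lt_top.2 fun z _ => ?_
      exact lt_of_le_of_lt (indicator_le_self _ _ _) (by simp)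
    -- Hitting events are under control for compact sets only. Inside a closed ball these are the
    -- traces of closed sets, a π-system generating the Borel sets; finiteness of the restricted
    -- measure allows the extension to all of them.
    refine Measurable.measure_of_isPiSystem
      (by rw [BorelSpace.measurable_eq (α := ℂ), borel_eq_generateFrom_isClosed])
      isPiSystem_isClosed (fun K hK => ?_) ?_
    · simp_rw [Measure.restrict_apply (IsClosed.measurableSet hK)]
      exact hcompact _ ((isCompact_closedBall 0 r).inter_left hK)
        (inter_subset_right.trans (hsub r hr))
    · simp_rw [Measure.restrict_apply_univ]
      exact hcompact _ (isCompact_closedBall 0 r) (hsub r hr)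
  obtain ⟨u, hu, hu1, hul⟩ := exists_seq_strictMono_tendsto (1 : ℝ)
  have hAe : A = ⋃ n, A ∩ Metric.closedBall 0 (u n) := by
    rw [← inter_iUnion]
    refine (inter_eq_left.2 fun z hz => ?_).symm
    obtain ⟨n, hn⟩ := (hul.eventually_const_lt (show ‖z‖ < 1 from hAD hz)).exists
    exact mem_iUnion.2 ⟨n, mem_closedBall_zero_iff.2 hn.le⟩
  have hmono : Monotone fun n => A ∩ Metric.closedBall (0 : ℂ) (u n) := fun m n hmn =>
    inter_subset_inter_right _ (Metric.closedBall_subset_closedBall (hu.monotone hmn))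
  have : (fun s => pointMeasure {z | z ∈ unitDisk ∧ f s z = 0} A) = fun s =>
      ⨆ n, (pointMeasure (Z s)).restrict (Metric.closedBall 0 (u n)) A := by
    ext s
    conv_lhs => rw [hAe]
    rw [hmono.measure_iUnion]
    simp_rw [Measure.restrict_apply hA]
    rfl
  rw [this]
  exact Measurable.iSup fun n => (Measure.measurable_coe hA).comp (hr (u n) (hu1 n))

end CountMeasurability

/-! ### Power series on the disk as functions of their coefficients. -/

section CoefficientSpace

lemma isOpen_unitDisk : IsOpen unitDisk := isOpen_lt continuous_norm continuous_const

lemma unitDisk_eq_ball : unitDisk = Metric.ball 0 1 := by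
  ext z
  simp [unitDisk]

/-- The sum of the power series with coefficients `c`. -/
def seriesSum (c : ℕ → ℂ) (z : ℂ) : ℂ := ∑' k, c k * z ^ k

/-- The sum of the derived power series. -/
def seriesDeriv (c : ℕ → ℂ) (z : ℂ) : ℂ := ∑' k, c k * (k * z ^ (k - 1))

/-- The power series with coefficients `c` converges absolutely in the unit disk. -/
def ConvergesOnDisk (c : ℕ → ℂ) : Prop :=
  ∀ n : ℕ, ∑' k, ENNReal.ofReal (‖c k‖ * (1 - 1 / ((n : ℝ) + 1)) ^ k) ≠ ∞

lemma one_sub_one_div_nonneg (n : ℕ) : 0 ≤ 1 - 1 / ((n : ℝ) + 1) := by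
  rw [sub_nonneg, div_le_one (by positivity)]
  linarith [(Nat.cast_nonneg n : (0 : ℝ) ≤ n)]

lemma convergesOnDisk_of_summable {c : ℕ → ℂ}
    (hc : ∀ n : ℕ, Summable fun k => ‖c k‖ * (1 - 1 / ((n : ℝ) + 1)) ^ k) : ConvergesOnDisk c :=
  fun n => (hc n).tsum_ofReal_ne_top

/-- Testing only countably many radii, through sums in `ℝ≥0∞`, is what makes this immediate. -/
lemma measurableSet_convergesOnDisk : MeasurableSet {c | ConvergesOnDisk c} := by
  simp only [ConvergesOnDisk, ofPred_forall]
  refine MeasurableSet.iInter fun n => ?_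
  have : Measurable fun c : ℕ → ℂ =>
      ∑' k, ENNReal.ofReal (‖c k‖ * (1 - 1 / ((n : ℝ) + 1)) ^ k) :=
    Measurable.tsum fun k => by fun_prop
  exact (this (measurableSet_singleton ∞)).compl

namespace ConvergesOnDisk

variable {c d : ℕ → ℂ}

lemma summable (hc : ConvergesOnDisk c) {r : ℝ} (h0 : 0 ≤ r) (h1 : r < 1) :
    Summable fun k => ‖c k‖ * r ^ k := by
  obtain ⟨n, hn⟩ := exists_nat_one_div_lt (sub_pos.2 h1)
  have hs : Summable fun k => ‖c k‖ * (1 - 1 / ((n : ℝ) + 1)) ^ k := by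
    refine (ENNReal.summable_toReal (hc n)).congr fun k => ?_
    rw [ENNReal.toReal_ofReal]
    exact mul_nonneg (norm_nonneg _) (pow_nonneg (one_sub_one_div_nonneg n) k)
  refine hs.of_nonneg_of_le (fun k => by positivity) fun k => ?_
  gcongr
  linarith

lemma summable_deriv (hc : ConvergesOnDisk c) {r : ℝ} (h0 : 0 ≤ r) (h1 : r < 1) :
    Summable fun k : ℕ => ‖c k‖ * (k * r ^ (k - 1)) := by
  -- Enlarging `r` to `s > 0` allows division by the radius when `r = 0`; the gap between `s` and
  -- `q` absorbs the factor `k`.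
  obtain ⟨s, hs0, hs1⟩ := exists_between h1
  have hs : 0 < s := h0.trans_lt hs0
  obtain ⟨q, hq0, hq1⟩ := exists_between hs1
  have hO : (fun k : ℕ => ‖c k‖ * (k * s ^ (k - 1))) =O[Filter.atTop] fun k => ‖c k‖ * q ^ k := by
    refine (Asymptotics.isBigO_refl _ _).mul ?_
    have h := (isLittleO_pow_const_mul_const_pow_const_pow_of_norm_lt (R := ℝ) 1
      (r₁ := s) (r₂ := q) (by rwa [Real.norm_of_nonneg hs.le])).isBigO
    refine Asymptotics.IsBigO.trans ?_ h
    refine (Asymptotics.isBigO_const_mul_self s⁻¹ _ _).congr_left fun k => ?_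
    cases k with
    | zero => simp
    | succ k => simp only [pow_one, Nat.add_sub_cancel]; field_simp; ring
  have := summable_of_isBigO_nat (hc.summable (hs.le.trans hq0.le) hq1) hO
  refine this.of_nonneg_of_le (fun k => by positivity) fun k => ?_
  gcongr

lemma hasSum (hc : ConvergesOnDisk c) {z : ℂ} (hz : z ∈ unitDisk) :
    HasSum (fun k => c k * z ^ k) (seriesSum c z) := by
  refine (Summable.of_norm ?_).hasSum
  simpa only [norm_mul, norm_pow] using hc.summable (norm_nonneg z) hz

lemma hasSum_deriv (hc : ConvergesOnDisk c) {z : ℂ} (hz : z ∈ unitDisk) :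
    HasSum (fun k : ℕ => c k * (k * z ^ (k - 1))) (seriesDeriv c z) := by
  refine (Summable.of_norm ?_).hasSum
  simpa only [norm_mul, norm_pow, Complex.norm_natCast] using hc.summable_deriv (norm_nonneg z) hz

lemma hasDerivAt (hc : ConvergesOnDisk c) {z : ℂ} (hz : z ∈ unitDisk) :
    HasDerivAt (seriesSum c) (seriesDeriv c z) z := by
  obtain ⟨r, hzr, hr1⟩ := exists_between (show ‖z‖ < 1 from hz)
  have hr0 := (norm_nonneg z).trans_lt hzr
  refine hasDerivAt_tsum_of_isPreconnected (t := Metric.ball 0 r)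
    (g' := fun k y => c k * (k * y ^ (k - 1))) (y₀ := 0)
    (hc.summable_deriv hr0.le hr1) Metric.isOpen_ball
    (convex_ball _ _).isPreconnected (fun k y _ => (hasDerivAt_pow k y).const_mul _)
    (fun k y hy => ?_) (Metric.mem_ball_self hr0) ?_ (by simpa using hzr)
  · rw [norm_mul, norm_mul, norm_pow, Complex.norm_natCast]
    have : ‖y‖ ≤ r := by simpa using (mem_ball_zero_iff.1 hy).le
    gcongr
  · exact (hc.hasSum (by simp [unitDisk])).summable

lemma differentiableOn (hc : ConvergesOnDisk c) : DifferentiableOn ℂ (seriesSum c) unitDisk :=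
  fun _ hz => (hc.hasDerivAt hz).differentiableAt.differentiableWithinAt

lemma add_const_mul (hc : ConvergesOnDisk c) (hd : ConvergesOnDisk d) (w : ℂ) :
    ConvergesOnDisk fun k => c k + w * d k := by
  refine convergesOnDisk_of_summable fun n => ?_
  have h0 := one_sub_one_div_nonneg n
  have h1 : 1 - 1 / ((n : ℝ) + 1) < 1 := by
    rw [sub_lt_self_iff]; positivity
  refine ((hc.summable h0 h1).add ((hd.summable h0 h1).mul_left ‖w‖)).of_nonneg_of_le
    (fun k => by positivity) fun k => ?_
  rw [← mul_assoc, ← add_mul, ← norm_mul]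
  gcongr
  exact norm_add_le _ _

lemma seriesSum_add_const_mul (hc : ConvergesOnDisk c) (hd : ConvergesOnDisk d) (w : ℂ) {z : ℂ}
    (hz : z ∈ unitDisk) :
    seriesSum (fun k => c k + w * d k) z = seriesSum c z + w * seriesSum d z := by
  refine HasSum.tsum_eq ?_
  simpa only [add_mul, mul_assoc] using (hc.hasSum hz).add ((hd.hasSum hz).mul_left w)

lemma seriesDeriv_add_const_mul (hc : ConvergesOnDisk c) (hd : ConvergesOnDisk d) (w : ℂ) {z : ℂ}
    (hz : z ∈ unitDisk) :
    seriesDeriv (fun k => c k + w * d k) z = seriesDeriv c z + w * seriesDeriv d z := by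
  refine HasSum.tsum_eq ?_
  simpa only [add_mul, mul_assoc] using (hc.hasSum_deriv hz).add ((hd.hasSum_deriv hz).mul_left w)

end ConvergesOnDisk

lemma seriesSum_zero_right (c : ℕ → ℂ) : seriesSum c 0 = c 0 := by
  rw [seriesSum, tsum_eq_single 0 fun k hk => by simp [hk]]
  simp

/-- Infinitely many zeros would accumulate in the compact disk, and the identity theorem would force
`f 0 = 0`. -/
lemma finite_zeros {f : ℂ → ℂ} (hf : DifferentiableOn ℂ f unitDisk) (h0 : f 0 ≠ 0) {r : ℝ}
    (hr : r < 1) : {z | ‖z‖ ≤ r ∧ f z = 0}.Finite := by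
  by_contra hinf
  obtain ⟨x, hx, hacc⟩ := Set.Infinite.exists_accPt_of_subset_isCompact hinf
    (isCompact_closedBall (0 : ℂ) r) fun z hz => mem_closedBall_zero_iff.2 hz.1
  have hxD : x ∈ unitDisk := (mem_closedBall_zero_iff.1 hx).trans_lt hr
  have hfreq : ∃ᶠ z in nhdsWithin x {x}ᶜ, f z = 0 :=
    (accPt_iff_frequently_nhdsNE.1 hacc).mono fun z hz => hz.2
  have hpre : IsPreconnected unitDisk := by
    rw [unitDisk_eq_ball]
    exact (convex_ball _ _).isPreconnected
  exact h0 ((hf.analyticOnNhd isOpen_unitDisk).eqOn_zero_of_preconnected_of_frequently_eq_zero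
    hpre hxD hfreq (by simp [unitDisk]))

open scoped Classical in
/-- The sum of a convergent power series with nonzero constant term, and the constant `1` for
other coefficients. -/
def regularizedSum (c : ℕ → ℂ) (z : ℂ) : ℂ :=
  if ConvergesOnDisk c ∧ c 0 ≠ 0 then seriesSum c z else 1

/-- Replacing bad sequences by the constant `1` secures continuity and finiteness of zeros for every
coefficient sequence, not just for almost every one. -/
lemma measurable_pointMeasure_regularizedSum {A : Set ℂ} (hA : MeasurableSet A)
    (hAD : A ⊆ unitDisk) :
    Measurable fun c => pointMeasure {z | z ∈ unitDisk ∧ regularizedSum c z = 0} A := by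
  classical
  refine measurable_pointMeasure_zeros (fun z hz => ?_) (fun c => ?_) (fun c r hr => ?_) hA hAD
  · have hG : MeasurableSet {c : ℕ → ℂ | ConvergesOnDisk c ∧ c 0 ≠ 0} :=
      measurableSet_convergesOnDisk.inter
        ((measurable_pi_apply 0 : Measurable fun c : ℕ → ℂ => c 0)
          (measurableSet_singleton (0 : ℂ)).compl)
    refine measurable_of_tendsto_metrizable (f := fun n c => if ConvergesOnDisk c ∧ c 0 ≠ 0 then
      ∑ k ∈ Finset.range n, c k * z ^ k else 1) (fun n => ?_) ?_
    · exact Measurable.ite hG (by fun_prop) measurable_const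
    · refine tendsto_pi_nhds.2 fun c => ?_
      unfold regularizedSum
      split_ifs with h
      · exact (h.1.hasSum hz).tendsto_sum_nat
      · exact tendsto_const_nhds
  · unfold regularizedSum
    split_ifs with h
    · exact h.1.differentiableOn.continuousOn
    · exact continuousOn_const
  · unfold regularizedSum
    split_ifs with h
    · exact finite_zeros h.1.differentiableOn (by rw [seriesSum_zero_right]; exact h.2) hr
    · simp

end CoefficientSpace

/-! ### Algebra of Gram determinants in `L²(F)`. -/

section Gram

variable {F : Measure ℝ}

lemma continuous_memLp [IsProbabilityMeasure F] {m : ℝ → ℂ} (hm : Continuous m) {C : ℝ} (hC : ∀ t, ‖m t‖ ≤ C) :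
    MemLp m 2 F :=
  MemLp.of_bound hm.aestronglyMeasurable C (.of_forall hC)

lemma ofReal_integral_norm_sq (m : ℝ → ℂ) :
    ((∫ t, ‖m t‖ ^ 2 ∂F : ℝ) : ℂ) = ∫ t, m t * conj (m t) ∂F := by
  rw [← integral_complex_ofReal]
  congr with t
  rw [Complex.mul_conj, Complex.normSq_eq_norm_sq]

lemma integral_mul_conj_comm (m n : ℝ → ℂ) :
    ∫ t, m t * conj (n t) ∂F = conj (∫ t, n t * conj (m t) ∂F) := by
  rw [← integral_conj]
  congr with t
  simp [mul_comm]

/-- Sesquilinear expansion of the covariance of two linear combinations. -/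
lemma integral_lincomb_mul_conj [IsProbabilityMeasure F] {m n : ℝ → ℂ} (hm : MemLp m 2 F) (hn : MemLp n 2 F)
    (a b c a' b' c' : ℂ) :
    ∫ t, (a + b * m t + c * n t) * conj (a' + b' * m t + c' * n t) ∂F =
      a * conj a' + a * conj b' * conj (∫ t, m t ∂F) + a * conj c' * conj (∫ t, n t ∂F) +
      b * conj a' * (∫ t, m t ∂F) + b * conj b' * (∫ t, m t * conj (m t) ∂F) +
      b * conj c' * conj (∫ t, n t * conj (m t) ∂F) +
      c * conj a' * (∫ t, n t ∂F) + c * conj b' * (∫ t, n t * conj (m t) ∂F) +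
      c * conj c' * (∫ t, n t * conj (n t) ∂F) := by
  have i1 := hm.integrable (by norm_num)
  have i2 := hn.integrable (by norm_num)
  have j1 := (memLp_conj hm).integrable (by norm_num)
  have j2 := (memLp_conj hn).integrable (by norm_num)
  have k1 : Integrable (fun t => m t * conj (m t)) F := hm.integrable_mul (memLp_conj hm)
  have k2 : Integrable (fun t => m t * conj (n t)) F := hm.integrable_mul (memLp_conj hn)
  have k3 : Integrable (fun t => n t * conj (m t)) F := hn.integrable_mul (memLp_conj hm)
  have k4 : Integrable (fun t => n t * conj (n t)) F := hn.integrable_mul (memLp_conj hn)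
  rw [← integral_mul_conj_comm m n, ← integral_conj, ← integral_conj]
  simp_rw [← integral_const_mul]
  have h0 : a * conj a' = ∫ t, a * conj a' ∂F := by simp
  rw [h0, ← integral_add (by fun_prop) (by fun_prop), ← integral_add (by fun_prop) (by fun_prop),
    ← integral_add (by fun_prop) (by fun_prop), ← integral_add (by fun_prop) (by fun_prop),
    ← integral_add (by fun_prop) (by fun_prop), ← integral_add (by fun_prop) (by fun_prop),
    ← integral_add (by fun_prop) (by fun_prop), ← integral_add (by fun_prop) (by fun_prop)]
  congr with t
  simp only [map_add, map_mul]
  ring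

/-- The Gaussian expectation of `integral_exp_neg_norm_sq_mul_norm_sq`, for `1 - m / h` and the
derivative of `-m / h`, as a ratio of Gram determinants. -/
lemma gram_ratio [IsProbabilityMeasure F] {m n : ℝ → ℂ} (hm : MemLp m 2 F) (hn : MemLp n 2 F) {h h' : ℂ} (hh : h ≠ 0)
    (h1 : ∫ t, m t ∂F = h) (h2 : ∫ t, n t ∂F = h') {u v : ℝ → ℂ}
    (hu : ∀ t, u t = 1 - m t / h) (hv : ∀ t, v t = -(n t / h - m t * h' / h ^ 2)) :
    ((∫ t, ‖v t‖ ^ 2 ∂F) * (1 + ∫ t, ‖u t‖ ^ 2 ∂F) - ‖∫ t, v t * conj (u t) ∂F‖ ^ 2) /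
        (1 + ∫ t, ‖u t‖ ^ 2 ∂F) ^ 2 =
      ((∫ t, ‖n t‖ ^ 2 ∂F) * (∫ t, ‖m t‖ ^ 2 ∂F) - ‖∫ t, n t * conj (m t) ∂F‖ ^ 2) /
        (∫ t, ‖m t‖ ^ 2 ∂F) ^ 2 := by
  have hu' : u = fun t => 1 + (-1 / h) * m t + 0 * n t := funext fun t => by rw [hu]; ring
  have hv' : v = fun t => 0 + (h' / h ^ 2) * m t + (-1 / h) * n t := funext fun t => by
    rw [hv]; ring
  have hhb : conj h ≠ 0 := by simpa using hh
  rw [← Complex.ofReal_inj]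
  push_cast
  simp_rw [← Complex.mul_conj', ofReal_integral_norm_sq, hu', hv',
    integral_lincomb_mul_conj hm hn, h1, h2]
  set K := ∫ t, m t * conj (m t) ∂F with hK
  set N := ∫ t, n t * conj (n t) ∂F
  set D := ∫ t, n t * conj (m t) ∂F
  have hKr : conj K = K := by rw [hK, ← integral_mul_conj_comm m m]
  simp only [map_add, map_mul, map_div₀, map_neg, map_one, map_zero, map_pow, Complex.conj_conj,
    hKr]
  -- The point is that `1 + ∫ |u|² = K / |h|²`. When `K = 0` both denominators vanish and both
  -- quotients are `0` by convention.
  by_cases hK0 : K = 0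
  · have e1 : (1 : ℂ) + (1 * 1 + 1 * (-1 / conj h) * conj h + 1 * 0 * conj h' + -1 / h * 1 * h +
      -1 / h * (-1 / conj h) * K + -1 / h * 0 * conj D + 0 * 1 * h' + 0 * (-1 / conj h) * D +
      0 * 0 * N) = 0 := by
      rw [hK0]; field_simp; ring
    rw [e1, hK0]
    simp
  · have e1 : (1 : ℂ) + (1 * 1 + 1 * (-1 / conj h) * conj h + 1 * 0 * conj h' + -1 / h * 1 * h +
      -1 / h * (-1 / conj h) * K + -1 / h * 0 * conj D + 0 * 1 * h' + 0 * (-1 / conj h) * D +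
      0 * 0 * N) = K / (h * conj h) := by
      field_simp; ring
    rw [e1]
    field_simp
    ring

/-- A Gram determinant is invariant under adding a multiple of one vector to the other. -/
lemma gram_shear [IsProbabilityMeasure F] {f n : ℝ → ℂ} (hf : MemLp f 2 F) (hn : MemLp n 2 F) (z : ℂ) {m : ℝ → ℂ}
    (hm : ∀ t, m t = f t - z * n t) :
    (∫ t, ‖n t‖ ^ 2 ∂F) * (∫ t, ‖m t‖ ^ 2 ∂F) - ‖∫ t, n t * conj (m t) ∂F‖ ^ 2 =
      (∫ t, ‖n t‖ ^ 2 ∂F) * (∫ t, ‖f t‖ ^ 2 ∂F) - ‖∫ t, n t * conj (f t) ∂F‖ ^ 2 := by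
  have hm' : m = fun t => 0 + 1 * f t + (-z) * n t := funext fun t => by rw [hm]; ring
  have hn' : n = fun t => 0 + 0 * f t + 1 * n t := funext fun t => by ring
  have h3 := integral_lincomb_mul_conj hf hn 0 0 1 0 1 (-z)
  rw [← Complex.ofReal_inj]
  push_cast
  simp_rw [← Complex.mul_conj', ofReal_integral_norm_sq]
  have e3 : ∫ t, n t * conj (m t) ∂F = ∫ t, (0 + 0 * f t + 1 * n t) *
      conj (0 + 1 * f t + (-z) * n t) ∂F := by
    congr with t; rw [hm']; ring
  rw [e3, h3, hm', integral_lincomb_mul_conj hf hn]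
  have hN : conj (∫ t, n t * conj (n t) ∂F) = ∫ t, n t * conj (n t) ∂F :=
    (integral_mul_conj_comm n n).symm
  simp only [map_add, map_mul, map_neg, map_one, map_zero, Complex.conj_conj, hN]
  ring

end Gram

/-! ### The Szegő kernel and the explicit intensity. -/

section Intensity

variable {F : Measure ℝ} {γ : ℤ → ℂ}

/-- The Szegő kernel `1 / (1 - z e^{-it})`. -/
def szego (z : ℂ) (t : ℝ) : ℂ := (1 - z * Complex.exp (-Complex.I * t))⁻¹

/-- The first intensity of the zeros, in terms of the spectral measure. -/
def intensity (F : Measure ℝ) (z : ℂ) : ℝ :=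
  1 / π * (((∫ t, ‖szego z t‖ ^ 4 ∂F) ^ 2 -
    ‖∫ t, ‖szego z t‖ ^ 4 • Complex.exp (Complex.I * t) ∂F‖ ^ 2) / (∫ t, ‖szego z t‖ ^ 2 ∂F) ^ 2)

lemma norm_exp_neg_I_mul' (t : ℝ) : ‖Complex.exp (-Complex.I * t)‖ = 1 := by
  simpa using norm_exp_neg_I_mul 1 t

lemma one_sub_norm_le {z : ℂ} (t : ℝ) :
    1 - ‖z‖ ≤ ‖1 - z * Complex.exp (-Complex.I * t)‖ := by
  have := norm_sub_norm_le (1 : ℂ) (z * Complex.exp (-Complex.I * t))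
  rwa [norm_mul, norm_exp_neg_I_mul', mul_one, norm_one] at this

lemma one_sub_ne_zero {z : ℂ} (hz : z ∈ unitDisk) (t : ℝ) :
    1 - z * Complex.exp (-Complex.I * t) ≠ 0 := by
  rw [← norm_pos_iff]
  exact (sub_pos.2 hz).trans_le (one_sub_norm_le t)

lemma norm_szego_le {z : ℂ} {r : ℝ} (hr : r < 1) (hz : ‖z‖ ≤ r) (t : ℝ) :
    ‖szego z t‖ ≤ (1 - r)⁻¹ := by
  rw [szego, norm_inv]
  have := one_sub_norm_le (z := z) t
  have : 0 < 1 - r := sub_pos.2 hr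
  gcongr
  linarith

lemma continuous_szego {z : ℂ} (hz : z ∈ unitDisk) : Continuous (szego z) := by
  unfold szego
  exact Continuous.inv₀ (by fun_prop) (one_sub_ne_zero hz)

lemma szego_ne_zero {z : ℂ} (hz : z ∈ unitDisk) (t : ℝ) : szego z t ≠ 0 :=
  inv_ne_zero (one_sub_ne_zero hz t)

/-- Dominated convergence, the kernel being bounded by `(1 - r)⁻¹` on `‖z‖ < r`. The factor `e` is
taken to be `1` or `e^{it}`. -/
lemma continuousOn_integral_szego [IsProbabilityMeasure F] {E : Type*} [NormedAddCommGroup E]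
    [NormedSpace ℝ E] {e : ℝ → E} (he : Continuous e) (he1 : ∀ t, ‖e t‖ ≤ 1) (n : ℕ)
    [SecondCountableTopology E] :
    ContinuousOn (fun z => ∫ t, ‖szego z t‖ ^ n • e t ∂F) unitDisk := by
  intro z hz
  obtain ⟨r, hzr, hr1⟩ := exists_between (show ‖z‖ < 1 from hz)
  have hev : ∀ᶠ y in nhds z, ‖y‖ < r := continuous_norm.continuousAt.eventually_lt_const hzr
  refine (continuousAt_of_dominated (bound := fun _ => ((1 - r)⁻¹) ^ n) ?_ ?_
    (integrable_const _) (.of_forall fun t => ?_)).continuousWithinAt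
  · filter_upwards [hev] with y hy
    exact (((continuous_szego (show y ∈ unitDisk from hy.trans hr1)).norm.pow n).smul
      he).aestronglyMeasurable
  · filter_upwards [hev] with y hy
    refine .of_forall fun t => ?_
    rw [norm_smul, norm_pow, norm_norm]
    calc ‖szego y t‖ ^ n * ‖e t‖ ≤ ((1 - r)⁻¹) ^ n * 1 := by
          have : 0 < 1 - r := sub_pos.2 hr1
          gcongr
          · exact norm_szego_le hr1 hy.le t
          · exact he1 t
      _ = _ := mul_one _
  · refine ContinuousAt.smul (ContinuousAt.pow (ContinuousAt.norm ?_) n) continuousAt_const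
    exact ContinuousAt.inv₀ (by fun_prop) (one_sub_ne_zero hz t)

lemma integrable_szego [IsProbabilityMeasure F] {z : ℂ} (hz : z ∈ unitDisk) {E : Type*}
    [NormedAddCommGroup E] [NormedSpace ℝ E] [SecondCountableTopology E] {e : ℝ → E}
    (he : Continuous e) (he1 : ∀ t, ‖e t‖ ≤ 1) (n : ℕ) :
    Integrable (fun t => ‖szego z t‖ ^ n • e t) F := by
  refine Integrable.of_bound (C := ((1 - ‖z‖)⁻¹) ^ n)
    (((continuous_szego hz).norm.pow n).smul he).aestronglyMeasurable (.of_forall fun t => ?_)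
  rw [norm_smul, norm_pow, norm_norm]
  calc ‖szego z t‖ ^ n * ‖e t‖ ≤ ((1 - ‖z‖)⁻¹) ^ n * 1 := by
        have : 0 < 1 - ‖z‖ := sub_pos.2 hz
        gcongr
        · exact norm_szego_le hz le_rfl t
        · exact he1 t
    _ = _ := mul_one _

lemma integral_szego_sq_pos [IsProbabilityMeasure F] {z : ℂ} (hz : z ∈ unitDisk) :
    0 < ∫ t, ‖szego z t‖ ^ 2 ∂F := by
  have hi : Integrable (fun t => ‖szego z t‖ ^ 2) F := by
    simpa using integrable_szego (F := F) hz (e := fun _ => (1 : ℝ)) continuous_const (by simp) 2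
  rw [integral_pos_iff_support_of_nonneg (fun t => by positivity) hi]
  have : (Function.support fun t => ‖szego z t‖ ^ 2) = univ :=
    eq_univ_of_forall fun t => pow_ne_zero 2 (norm_ne_zero_iff.2 (szego_ne_zero hz t))
  rw [this]
  simp

lemma continuousOn_intensity [IsProbabilityMeasure F] : ContinuousOn (intensity F) unitDisk := by
  have h4 : ContinuousOn (fun z => ∫ t, ‖szego z t‖ ^ 4 ∂F) unitDisk := by
    simpa using continuousOn_integral_szego (F := F) (e := fun _ => (1 : ℝ)) continuous_const
      (by simp) 4
  have h2 : ContinuousOn (fun z => ∫ t, ‖szego z t‖ ^ 2 ∂F) unitDisk := by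
    simpa using continuousOn_integral_szego (F := F) (e := fun _ => (1 : ℝ)) continuous_const
      (by simp) 2
  have hb := continuousOn_integral_szego (F := F) (e := fun t : ℝ => Complex.exp (Complex.I * t))
    (by fun_prop) (fun t => by rw [mul_comm, Complex.norm_exp_ofReal_mul_I]) 4
  refine continuousOn_const.mul (((h4.pow 2).sub (hb.norm.pow 2)).div (h2.pow 2) fun z hz => ?_)
  exact pow_ne_zero 2 (integral_szego_sq_pos hz).ne'

lemma intensity_nonneg (z : ℂ) : 0 ≤ intensity F z := by
  refine mul_nonneg (by positivity) (div_nonneg (sub_nonneg.2 ?_) (sq_nonneg _))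
  gcongr
  refine (norm_integral_le_integral_norm _).trans_eq ?_
  congr with t
  rw [norm_smul, mul_comm Complex.I, Complex.norm_exp_ofReal_mul_I]
  simp

lemma memLp_exp_mul_szego_sq [IsProbabilityMeasure F] {z : ℂ} (hz : z ∈ unitDisk) :
    MemLp (fun t : ℝ => Complex.exp (-Complex.I * t) * szego z t ^ 2) 2 F := by
  refine continuous_memLp (Continuous.mul (by fun_prop) ((continuous_szego hz).pow 2))
    (C := ((1 - ‖z‖)⁻¹) ^ 2) fun t => ?_
  rw [norm_mul, norm_exp_neg_I_mul', one_mul, norm_pow]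
  gcongr
  exact norm_szego_le hz le_rfl t

/-- The intensity as a Gram determinant of the Szegő kernel and its derivative. -/
lemma intensity_eq_gram [IsProbabilityMeasure F] {z : ℂ} (hz : z ∈ unitDisk) :
    intensity F z = 1 / π *
      (((∫ t, ‖Complex.exp (-Complex.I * t) * szego z t ^ 2‖ ^ 2 ∂F) *
        (∫ t, ‖szego z t‖ ^ 2 ∂F) -
        ‖∫ t, Complex.exp (-Complex.I * t) * szego z t ^ 2 * conj (szego z t) ∂F‖ ^ 2) /
        (∫ t, ‖szego z t‖ ^ 2 ∂F) ^ 2) := by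
  have hb : ∀ t, ‖szego z t‖ ≤ (1 - ‖z‖)⁻¹ := norm_szego_le hz le_rfl
  have hc := continuous_szego hz
  have hf : MemLp (fun t => szego z t ^ 2) 2 F := by
    refine continuous_memLp (hc.pow 2) (C := ((1 - ‖z‖)⁻¹) ^ 2) fun t => ?_
    rw [norm_pow]
    gcongr
    exact hb t
  have hn := memLp_exp_mul_szego_sq (F := F) hz
  -- The shear is `S = S² - z e^{-it} S²`, a rewriting of `S = S² (1 - z e^{-it})`.
  rw [gram_shear hf hn z (m := szego z) fun t => ?_]
  · have e1 : ∀ t : ℝ, ‖Complex.exp (-Complex.I * t) * szego z t ^ 2‖ ^ 2 = ‖szego z t‖ ^ 4 :=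
      fun t => by rw [norm_mul, norm_exp_neg_I_mul', one_mul, norm_pow]; ring
    have e2 : ∀ t : ℝ, ‖szego z t ^ 2‖ ^ 2 = ‖szego z t‖ ^ 4 := fun t => by rw [norm_pow]; ring
    have e3 : ∀ t : ℝ, Complex.exp (-Complex.I * t) * szego z t ^ 2 * conj (szego z t ^ 2) =
        conj (‖szego z t‖ ^ 4 • Complex.exp (Complex.I * t)) := fun t => by
      rw [mul_assoc, Complex.mul_conj', norm_pow, Complex.real_smul, map_mul, Complex.conj_ofReal,
        ← Complex.exp_conj, mul_comm]
      congr 1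
      · push_cast; ring
      · simp
    simp_rw [e1, e2, e3]
    rw [integral_conj, RCLike.norm_conj, intensity, sq (∫ t, ‖szego z t‖ ^ 4 ∂F)]
  · have h := one_sub_ne_zero hz t
    simp only [szego]
    field_simp

lemma normSq_one_sub (r φ t : ℝ) :
    ‖1 - (r : ℂ) * Complex.exp (Complex.I * φ) * Complex.exp (-Complex.I * t)‖ ^ 2 =
      1 - 2 * r * Real.cos (t - φ) + r ^ 2 := by
  have h : (r : ℂ) * Complex.exp (Complex.I * φ) * Complex.exp (-Complex.I * t) =
      ⟨r * Real.cos (t - φ), -(r * Real.sin (t - φ))⟩ := by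
    rw [mul_assoc, ← Complex.exp_add, show Complex.I * (φ : ℂ) + -Complex.I * t =
      ((-(t - φ) : ℝ) : ℂ) * Complex.I by push_cast; ring]
    apply Complex.ext
    · rw [Complex.re_ofReal_mul, Complex.exp_ofReal_mul_I_re, Real.cos_neg]
    · rw [Complex.im_ofReal_mul, Complex.exp_ofReal_mul_I_im, Real.sin_neg, mul_neg]
  rw [h, Complex.sq_norm, Complex.normSq_apply]
  simp only [Complex.sub_re, Complex.one_re, Complex.sub_im, Complex.one_im]
  linear_combination r ^ 2 * Real.sin_sq_add_cos_sq (t - φ)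

lemma poissonKernel_sub (r φ t : ℝ) :
    poissonKernel r (t - φ) =
      (1 - r ^ 2) * ‖szego ((r : ℂ) * Complex.exp (Complex.I * φ)) t‖ ^ 2 := by
  rw [szego, norm_inv, inv_pow, normSq_one_sub, poissonKernel, div_eq_mul_inv]

/-- Angles enter the final formula only through cosines, so the integer is harmless. -/
lemma shiftMod_eq (φ t : ℝ) : ∃ n : ℤ, shiftMod φ t = t - φ + n * (2 * π) := by
  refine ⟨-toIocDiv Real.two_pi_pos (-π) (t - φ), ?_⟩
  rw [shiftMod, toIocMod]
  push_cast
  rw [zsmul_eq_mul]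
  ring

lemma cos_shiftMod (φ t : ℝ) : Real.cos (shiftMod φ t) = Real.cos (t - φ) := by
  obtain ⟨n, hn⟩ := shiftMod_eq φ t
  rw [hn, Real.cos_add_int_mul_two_pi]

lemma cos_shiftMod_sub (φ t s : ℝ) :
    Real.cos (shiftMod φ t - shiftMod φ s) = Real.cos (t - s) := by
  obtain ⟨n, hn⟩ := shiftMod_eq φ t
  obtain ⟨k, hk⟩ := shiftMod_eq φ s
  rw [hn, hk, show t - φ + n * (2 * π) - (s - φ + k * (2 * π)) =
    t - s + ((n - k : ℤ) : ℝ) * (2 * π) by push_cast; ring, Real.cos_add_int_mul_two_pi]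

lemma poissonKernel_shiftMod (r φ t : ℝ) :
    poissonKernel r (shiftMod φ t) = poissonKernel r (t - φ) := by
  simp only [poissonKernel, cos_shiftMod]

lemma setIntegral_rotate (F : Measure ℝ) (φ : ℝ) {f : ℝ → ℝ} (hf : Measurable f) :
    ∫ t in Ioc (-π) π, f t ∂(rotate F φ) = ∫ t, f (shiftMod φ t) ∂F := by
  have hmem : ∀ t, shiftMod φ t ∈ Ioc (-π) π := fun t => by
    have := toIocMod_mem_Ioc Real.two_pi_pos (-π) (t - φ)
    rwa [show -π + 2 * π = π by ring] at this
  have : (rotate F φ).restrict (Ioc (-π) π) = rotate F φ := by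
    refine Measure.restrict_eq_self_of_ae_mem ?_
    exact (ae_map_iff (measurable_shiftMod φ).aemeasurable measurableSet_Ioc).2 (.of_forall hmem)
  rw [this, rotate, integral_map (measurable_shiftMod φ).aemeasurable hf.aestronglyMeasurable]

lemma measurable_poissonKernel (r : ℝ) : Measurable (poissonKernel r) := by
  unfold poissonKernel
  fun_prop

lemma integral_const_mul_sub_sub {f g h : ℝ → ℝ} (hf : Integrable f F) (hg : Integrable g F)
    (hh : Integrable h F) (a b c : ℝ) :
    ∫ t, (a * f t - b * g t - c * h t) ∂F =
      a * ∫ t, f t ∂F - b * ∫ t, g t ∂F - c * ∫ t, h t ∂F := by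
  rw [integral_sub (f := fun t => a * f t - b * g t) ((hf.const_mul _).sub (hg.const_mul _))
    (hh.const_mul _), integral_sub (hf.const_mul _) (hg.const_mul _), integral_const_mul,
    integral_const_mul, integral_const_mul]

/-- Expanding `cos (t - s)` factors the double integral into `A² - C² - S²`, with `C` and `S` the
real and imaginary parts of the integral of `e^{it}`. -/
lemma integral_integral_one_sub_cos [IsProbabilityMeasure F] {z : ℂ} (hz : z ∈ unitDisk) :
    ∫ t, ∫ s, (1 - Real.cos (t - s)) * ‖szego z s‖ ^ 4 * ‖szego z t‖ ^ 4 ∂F ∂F =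
      (∫ t, ‖szego z t‖ ^ 4 ∂F) ^ 2 -
        ‖∫ t, ‖szego z t‖ ^ 4 • Complex.exp (Complex.I * t) ∂F‖ ^ 2 := by
  have i1 : Integrable (fun t => ‖szego z t‖ ^ 4) F := by
    simpa using integrable_szego (F := F) hz (e := fun _ => (1 : ℝ)) continuous_const (by simp) 4
  have ic : Integrable (fun t => ‖szego z t‖ ^ 4 * Real.cos t) F :=
    integrable_szego (F := F) hz (e := Real.cos) Real.continuous_cos Real.abs_cos_le_one 4
  have is : Integrable (fun t => ‖szego z t‖ ^ 4 * Real.sin t) F :=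
    integrable_szego (F := F) hz (e := Real.sin) Real.continuous_sin Real.abs_sin_le_one 4
  have ie := integrable_szego (F := F) hz (e := fun t : ℝ => Complex.exp (Complex.I * t))
    (by fun_prop) (fun t => by rw [mul_comm, Complex.norm_exp_ofReal_mul_I]) 4
  set A := ∫ t, ‖szego z t‖ ^ 4 ∂F
  set C := ∫ t, ‖szego z t‖ ^ 4 * Real.cos t ∂F with hC
  set S := ∫ t, ‖szego z t‖ ^ 4 * Real.sin t ∂F with hS
  have hre : (∫ t, ‖szego z t‖ ^ 4 • Complex.exp (Complex.I * t) ∂F).re = C := by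
    rw [← integral_complex_re ie, hC]
    congr with t
    rw [Complex.smul_re, mul_comm Complex.I, Complex.exp_ofReal_mul_I_re, smul_eq_mul]
  have him : (∫ t, ‖szego z t‖ ^ 4 • Complex.exp (Complex.I * t) ∂F).im = S := by
    have h : ∫ t, (‖szego z t‖ ^ 4 • Complex.exp (Complex.I * t)).im ∂F = _ :=
      Complex.imCLM.integral_comp_comm ie
    rw [Complex.imCLM_apply] at h
    rw [← h, hS]
    congr with t
    rw [Complex.smul_im, mul_comm Complex.I, Complex.exp_ofReal_mul_I_im, smul_eq_mul]
  rw [Complex.sq_norm, Complex.normSq_apply, hre, him]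
  have hin : ∀ t, ∫ s, (1 - Real.cos (t - s)) * ‖szego z s‖ ^ 4 * ‖szego z t‖ ^ 4 ∂F =
      A * ‖szego z t‖ ^ 4 - C * (‖szego z t‖ ^ 4 * Real.cos t) -
        S * (‖szego z t‖ ^ 4 * Real.sin t) := fun t => by
    have : ∀ s, (1 - Real.cos (t - s)) * ‖szego z s‖ ^ 4 * ‖szego z t‖ ^ 4 =
        ‖szego z t‖ ^ 4 * ‖szego z s‖ ^ 4
        - (‖szego z t‖ ^ 4 * Real.cos t) * (‖szego z s‖ ^ 4 * Real.cos s)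
        - (‖szego z t‖ ^ 4 * Real.sin t) * (‖szego z s‖ ^ 4 * Real.sin s) := fun s => by
      rw [Real.cos_sub]; ring
    simp_rw [this]
    refine (integral_const_mul_sub_sub i1 ic is _ _ _).trans ?_
    ring
  simp_rw [hin]
  refine (integral_const_mul_sub_sub i1 ic is _ _ _).trans ?_
  ring

/-- The intensity in polar coordinates, in terms of the Poisson kernel. -/
lemma intensity_polar [IsProbabilityMeasure F] {r : ℝ} (φ : ℝ) (h0 : 0 ≤ r) (h1 : r < 1) :
    intensity F ((r : ℂ) * Complex.exp (Complex.I * (φ : ℂ))) =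
      1 / (π * (1 - r ^ 2) ^ 2) *
        ((∫ t in Ioc (-π) π, ∫ s in Ioc (-π) π,
            (1 - Real.cos (t - s)) * poissonKernel r s ^ 2 * poissonKernel r t ^ 2
            ∂(rotate F φ) ∂(rotate F φ)) /
          (∫ s in Ioc (-π) π, poissonKernel r s ∂(rotate F φ)) ^ 2) := by
  set z : ℂ := (r : ℂ) * Complex.exp (Complex.I * (φ : ℂ)) with hz_def
  have hz : z ∈ unitDisk := by
    change ‖z‖ < 1
    rw [hz_def, norm_mul, mul_comm Complex.I, Complex.norm_exp_ofReal_mul_I, mul_one,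
      Complex.norm_real, Real.norm_of_nonneg h0]
    exact h1
  have hm := measurable_poissonKernel r
  have hden : ∫ s in Ioc (-π) π, poissonKernel r s ∂(rotate F φ) =
      (1 - r ^ 2) * ∫ t, ‖szego z t‖ ^ 2 ∂F := by
    rw [setIntegral_rotate F φ hm, ← integral_const_mul]
    simp_rw [poissonKernel_shiftMod, poissonKernel_sub]
    rfl
  have hinner : ∀ t, ∫ s in Ioc (-π) π,
      (1 - Real.cos (t - s)) * poissonKernel r s ^ 2 * poissonKernel r t ^ 2 ∂(rotate F φ) =
      ∫ s, (1 - Real.cos (t - shiftMod φ s)) * poissonKernel r (shiftMod φ s) ^ 2 *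
        poissonKernel r t ^ 2 ∂F := fun t => setIntegral_rotate F φ
          (f := fun s => (1 - Real.cos (t - s)) * poissonKernel r s ^ 2 * poissonKernel r t ^ 2)
          (by fun_prop)
  have : IsProbabilityMeasure (rotate F φ) :=
    Measure.isProbabilityMeasure_map (measurable_shiftMod φ).aemeasurable
  have houter : Measurable fun t => ∫ s in Ioc (-π) π,
      (1 - Real.cos (t - s)) * poissonKernel r s ^ 2 * poissonKernel r t ^ 2 ∂(rotate F φ) := by
    refine StronglyMeasurable.measurable ?_
    refine StronglyMeasurable.integral_prod_right (f := fun t s =>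
      (1 - Real.cos (t - s)) * poissonKernel r s ^ 2 * poissonKernel r t ^ 2) ?_
    refine Measurable.stronglyMeasurable ?_
    fun_prop
  have hnum : ∫ t in Ioc (-π) π, ∫ s in Ioc (-π) π,
      (1 - Real.cos (t - s)) * poissonKernel r s ^ 2 * poissonKernel r t ^ 2
      ∂(rotate F φ) ∂(rotate F φ) = (1 - r ^ 2) ^ 4 *
      ((∫ t, ‖szego z t‖ ^ 4 ∂F) ^ 2 -
        ‖∫ t, ‖szego z t‖ ^ 4 • Complex.exp (Complex.I * t) ∂F‖ ^ 2) := by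
    rw [setIntegral_rotate F φ houter, ← integral_integral_one_sub_cos hz]
    simp_rw [hinner, cos_shiftMod_sub, poissonKernel_shiftMod, poissonKernel_sub,
      ← integral_const_mul]
    congr with t
    congr with s
    ring
  -- The powers of `1 - r²` balance: four from the numerator, two from the squared denominator, two
  -- from the prefactor.
  rw [hnum, hden, intensity]
  have hr : (1 - r ^ 2) ≠ 0 := by nlinarith
  have hK := (integral_szego_sq_pos (F := F) hz).ne'
  field_simp

end Intensity

/-! ### The ratio `-Y / h` and its pointwise Gaussian expectation. -/

section Projection

variable {F : Measure ℝ} {γ : ℤ → ℂ}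

/-- The coefficients `e^{-ikt}`, whose power series is the Szegő kernel. -/
def expCoeff (t : ℝ) (k : ℕ) : ℂ := Complex.exp (-Complex.I * (k : ℤ) * t)

lemma symbol_eq (u : ℕ → ℂ) (t : ℝ) : symbol u t = ∑' k, u k * expCoeff t k := rfl

lemma norm_expCoeff (t : ℝ) (k : ℕ) : ‖expCoeff t k‖ = 1 := norm_exp_neg_I_mul _ _

lemma convergesOnDisk_of_norm_le_one {c : ℕ → ℂ} (hc : ∀ k, ‖c k‖ ≤ 1) : ConvergesOnDisk c := by
  refine convergesOnDisk_of_summable fun n => ?_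
  have h0 := one_sub_one_div_nonneg n
  have h1 : 1 - 1 / ((n : ℝ) + 1) < 1 := by
    rw [sub_lt_self_iff]; positivity
  refine (summable_geometric_of_lt_one h0 h1).of_nonneg_of_le (fun k => by positivity) fun k => ?_
  exact mul_le_of_le_one_left (by positivity) (hc k)

lemma convergesOnDisk_expCoeff (t : ℝ) : ConvergesOnDisk (expCoeff t) :=
  convergesOnDisk_of_norm_le_one fun k => (norm_expCoeff t k).le

lemma seriesSum_expCoeff (t : ℝ) {z : ℂ} (hz : z ∈ unitDisk) :
    seriesSum (expCoeff t) z = szego z t := by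
  have h : ‖z * Complex.exp (-Complex.I * t)‖ < 1 := by
    rw [norm_mul, norm_exp_neg_I_mul', mul_one]
    exact hz
  refine ((hasSum_geometric_of_norm_lt_one h).congr_fun fun k => ?_).tsum_eq
  rw [mul_pow, ← Complex.exp_nat_mul, expCoeff, mul_comm]
  congr 2
  push_cast
  ring

/-- The termwise derivative and the derivative of the closed form agree by uniqueness. -/
lemma seriesDeriv_expCoeff (t : ℝ) {z : ℂ} (hz : z ∈ unitDisk) :
    seriesDeriv (expCoeff t) z = Complex.exp (-Complex.I * t) * szego z t ^ 2 := by
  have h1 := (convergesOnDisk_expCoeff t).hasDerivAt hz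
  have h2 : HasDerivAt (fun z => szego z t) (Complex.exp (-Complex.I * t) * szego z t ^ 2) z := by
    have := (((hasDerivAt_id z).mul_const (Complex.exp (-Complex.I * t))).const_sub 1).inv
      (one_sub_ne_zero hz t)
    refine this.congr_deriv ?_
    simp [szego, div_eq_mul_inv]
  refine h1.unique (h2.congr_of_eventuallyEq ?_)
  filter_upwards [isOpen_unitDisk.mem_nhds hz] with y hy
  exact seriesSum_expCoeff t hy

namespace IsSpectralMeasure

lemma norm_covariance_le (hF : IsSpectralMeasure F γ) (k : ℤ) : ‖γ k‖ ≤ 1 := by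
  have := hF.isProbabilityMeasure
  rw [hF.covariance_eq]
  refine (norm_integral_le_integral_norm _).trans ?_
  simp_rw [norm_exp_neg_I_mul]
  simp

lemma convergesOnDisk (hF : IsSpectralMeasure F γ) : ConvergesOnDisk fun k : ℕ => γ k :=
  convergesOnDisk_of_norm_le_one fun k => hF.norm_covariance_le k

lemma tsum_mul_covariance (hF : IsSpectralMeasure F γ) {a : ℕ → ℂ} (ha : Summable fun k => ‖a k‖) :
    ∑' k : ℕ, a k * γ k = ∫ t, symbol a t ∂F := by
  have := hF.isProbabilityMeasure
  have hn : ∀ (k : ℕ) (t : ℝ), ‖a k * Complex.exp (-Complex.I * (k : ℤ) * t)‖ = ‖a k‖ :=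
    fun k t => by rw [norm_mul, norm_exp_neg_I_mul, mul_one]
  have h := integral_tsum_of_summable_integral_norm (μ := F)
    (F := fun (k : ℕ) (t : ℝ) => a k * Complex.exp (-Complex.I * (k : ℤ) * t))
    (fun k => Integrable.of_bound (C := ‖a k‖)
      (Continuous.aestronglyMeasurable (by fun_prop)) (.of_forall fun t => (hn k t).le))
    (by simpa only [hn, integral_const, probReal_univ, one_smul] using ha)
  refine Eq.trans ?_ h
  congr with k
  rw [integral_const_mul, hF.covariance_eq]

lemma seriesSum_covariance (hF : IsSpectralMeasure F γ) {z : ℂ} (hz : z ∈ unitDisk) :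
    seriesSum (fun k : ℕ => γ k) z = ∫ t, szego z t ∂F := by
  have ha : Summable fun k : ℕ => ‖z ^ k‖ := by
    simpa only [norm_pow] using summable_geometric_of_lt_one (norm_nonneg z) hz
  have h := hF.tsum_mul_covariance ha
  simp_rw [symbol_eq, mul_comm (z ^ _)] at h
  rw [seriesSum, h]
  congr with t
  exact seriesSum_expCoeff t hz

lemma seriesDeriv_covariance (hF : IsSpectralMeasure F γ) {z : ℂ} (hz : z ∈ unitDisk) :
    seriesDeriv (fun k : ℕ => γ k) z = ∫ t, Complex.exp (-Complex.I * t) * szego z t ^ 2 ∂F := by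
  have ha : Summable fun k : ℕ => ‖(k : ℂ) * z ^ (k - 1)‖ := by
    have := (convergesOnDisk_expCoeff 0).summable_deriv (norm_nonneg z) hz
    simpa only [norm_expCoeff, one_mul, norm_mul, norm_pow, Complex.norm_natCast] using this
  have h := hF.tsum_mul_covariance ha
  simp_rw [symbol_eq, mul_comm ((_ : ℂ) * z ^ _)] at h
  rw [seriesDeriv, h]
  congr with t
  exact seriesDeriv_expCoeff t hz

/-- The map `x ↦ 1 / (1 - x)` sends the unit disk onto the half-plane `Re > 1/2`. Averaging over `F`
keeps the bound, which is why `h` has no zeros. -/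
lemma half_le_re_szego {z : ℂ} (hz : z ∈ unitDisk) (t : ℝ) : 1 / 2 ≤ (szego z t).re := by
  set x := z * Complex.exp (-Complex.I * t) with hx
  have hx1 : Complex.normSq x < 1 := by
    rw [Complex.normSq_eq_norm_sq, hx, norm_mul, norm_exp_neg_I_mul', mul_one]
    have : ‖z‖ < 1 := hz
    nlinarith [norm_nonneg z]
  have hne : 0 < Complex.normSq (1 - x) := Complex.normSq_pos.2 (one_sub_ne_zero hz t)
  rw [szego, Complex.inv_re, ← hx, le_div_iff₀ hne]
  rw [Complex.normSq_apply] at hx1 ⊢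
  simp only [Complex.sub_re, Complex.one_re, Complex.sub_im, Complex.one_im]
  nlinarith

lemma seriesSum_covariance_ne_zero (hF : IsSpectralMeasure F γ) {z : ℂ} (hz : z ∈ unitDisk) :
    seriesSum (fun k : ℕ => γ k) z ≠ 0 := by
  have := hF.isProbabilityMeasure
  have hi : Integrable (szego z) F := Integrable.of_bound (C := (1 - ‖z‖)⁻¹)
    (continuous_szego hz).aestronglyMeasurable (.of_forall (norm_szego_le hz le_rfl))
  intro h0
  have h1 : (∫ t, szego z t ∂F).re = 0 := by rw [← hF.seriesSum_covariance hz, h0]; rfl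
  rw [← integral_complex_re hi] at h1
  have h2 : ∫ _, (1 / 2 : ℝ) ∂F ≤ ∫ t, (szego z t).re ∂F :=
    integral_mono (integrable_const _) hi.re fun t => half_le_re_szego hz t
  rw [h1] at h2
  norm_num at h2

end IsSpectralMeasure

/-- The function `-Y / h`, for the power series `Y` with coefficients `y` and `h` the power series
with coefficients `γ`. -/
def ratio (γ : ℤ → ℂ) (y : ℕ → ℂ) (z : ℂ) : ℂ := -(seriesSum y z / seriesSum (fun k : ℕ => γ k) z)

/-- The derivative of `ratio`. -/
def ratioDeriv (γ : ℤ → ℂ) (y : ℕ → ℂ) (z : ℂ) : ℂ :=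
  -(seriesDeriv y z / seriesSum (fun k : ℕ => γ k) z -
    seriesSum y z * seriesDeriv (fun k : ℕ => γ k) z / seriesSum (fun k : ℕ => γ k) z ^ 2)

lemma hasDerivAt_ratio (hF : IsSpectralMeasure F γ) {y : ℕ → ℂ} (hy : ConvergesOnDisk y) {z : ℂ}
    (hz : z ∈ unitDisk) : HasDerivAt (ratio γ y) (ratioDeriv γ y z) z := by
  have hH := hF.seriesSum_covariance_ne_zero hz
  refine ((hy.hasDerivAt hz).div (hF.convergesOnDisk.hasDerivAt hz) hH).neg.congr_deriv ?_
  rw [ratioDeriv]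
  field_simp

/-- The coefficients of `ξ_0 - X(z) / h(z)` as a linear form in `ξ`. -/
def ratioCoeff (γ : ℤ → ℂ) (z : ℂ) (k : ℕ) : ℂ :=
  (if k = 0 then 1 else 0) - z ^ k / seriesSum (fun k : ℕ => γ k) z

/-- The coefficients of the derivative of `-X / h` at `z` as a linear form in `ξ`. -/
def ratioDerivCoeff (γ : ℤ → ℂ) (z : ℂ) (k : ℕ) : ℂ :=
  -(k * z ^ (k - 1) / seriesSum (fun k : ℕ => γ k) z -
    z ^ k * seriesDeriv (fun k : ℕ => γ k) z / seriesSum (fun k : ℕ => γ k) z ^ 2)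

lemma summable_norm_ratioCoeff (γ : ℤ → ℂ) {z : ℂ} (hz : z ∈ unitDisk) :
    Summable fun k => ‖ratioCoeff γ z k‖ := by
  refine Summable.norm ?_
  refine Summable.sub (summable_of_hasFiniteSupport ((finite_singleton 0).subset fun k hk => ?_)) ?_
  · by_contra h
    exact hk (if_neg h)
  · exact (summable_geometric_of_norm_lt_one hz).div_const _

lemma summable_norm_ratioDerivCoeff (γ : ℤ → ℂ) {z : ℂ} (hz : z ∈ unitDisk) :
    Summable fun k => ‖ratioDerivCoeff γ z k‖ := by
  have h1 : ConvergesOnDisk fun _ => 1 := convergesOnDisk_of_norm_le_one fun k => by simp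
  have h2 := (h1.hasSum_deriv hz).summable
  simp only [one_mul] at h2
  refine Summable.norm (Summable.neg (Summable.sub (h2.div_const _) ?_))
  exact ((summable_geometric_of_norm_lt_one hz).mul_right _).div_const _

lemma tsum_ratioCoeff_mul (γ : ℤ → ℂ) {c : ℕ → ℂ} (hc : ConvergesOnDisk c) {z : ℂ}
    (hz : z ∈ unitDisk) :
    ∑' k, ratioCoeff γ z k * c k = c 0 - seriesSum c z / seriesSum (fun k : ℕ => γ k) z := by
  refine HasSum.tsum_eq ?_
  have h := (hasSum_ite_eq 0 (c 0)).sub ((hc.hasSum hz).div_const (seriesSum (fun k : ℕ => γ k) z))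
  refine h.congr_fun fun k => ?_
  rw [ratioCoeff]
  split_ifs with hk
  · rw [hk]; ring
  · ring

lemma tsum_ratioDerivCoeff_mul (γ : ℤ → ℂ) {c : ℕ → ℂ} (hc : ConvergesOnDisk c) {z : ℂ}
    (hz : z ∈ unitDisk) : ∑' k, ratioDerivCoeff γ z k * c k = ratioDeriv γ c z := by
  refine HasSum.tsum_eq ?_
  refine ((((hc.hasSum_deriv hz).div_const _).sub
    (((hc.hasSum hz).mul_right _).div_const _)).neg).congr_fun fun k => ?_
  rw [ratioDerivCoeff]
  ring

/-- The pointwise Gaussian expectation in the Kac–Rice formula. -/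
lemma integral_exp_ratio {Ω : Type*} [MeasurableSpace Ω] {P : Measure Ω} {ξ : ℤ → Ω → ℂ}
    (hξ : IsStationaryComplexGaussian P ξ γ) (hF : IsSpectralMeasure F γ) {z : ℂ}
    (hz : z ∈ unitDisk) :
    1 / π * ∫ ω, Real.exp (-‖linearForm ξ (ratioCoeff γ z) ω‖ ^ 2) *
      ‖linearForm ξ (ratioDerivCoeff γ z) ω‖ ^ 2 ∂P = intensity F z := by
  have := hF.isProbabilityMeasure
  rw [hξ.integral_exp_neg_norm_sq_linearForm hF (summable_norm_ratioCoeff γ hz)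
    (summable_norm_ratioDerivCoeff γ hz), intensity_eq_gram hz]
  congr 1
  have hb : ∀ t, ‖szego z t‖ ≤ (1 - ‖z‖)⁻¹ := norm_szego_le hz le_rfl
  have hc := continuous_szego hz
  refine gram_ratio (continuous_memLp hc hb) (memLp_exp_mul_szego_sq hz)
    (hF.seriesSum_covariance_ne_zero hz) (hF.seriesSum_covariance hz).symm
    (hF.seriesDeriv_covariance hz).symm (fun t => ?_) fun t => ?_
  · rw [symbol_eq, tsum_ratioCoeff_mul γ (convergesOnDisk_expCoeff t) hz, seriesSum_expCoeff t hz]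
    simp [expCoeff]
  · rw [symbol_eq, tsum_ratioDerivCoeff_mul γ (convergesOnDisk_expCoeff t) hz, ratioDeriv,
      seriesSum_expCoeff t hz, seriesDeriv_expCoeff t hz]

end Projection

/-! ### The residual coefficients after regression on `ξ_0`. -/

namespace IsStationaryComplexGaussian

/-- The part of the coefficient sequence orthogonal to `ξ_0`. -/
def residual {Ω : Type*} (ξ : ℤ → Ω → ℂ) (γ : ℤ → ℂ) (k : ℕ) (ω : Ω) : ℂ := ξ k ω + -ξ 0 ω * γ k

lemma residual_add {Ω : Type*} (ξ : ℤ → Ω → ℂ) (γ : ℤ → ℂ) (k : ℕ) (ω : Ω) :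
    residual ξ γ k ω + ξ 0 ω * γ k = ξ k ω := by
  rw [residual]
  ring

end IsStationaryComplexGaussian

/-! ### The mean number of zeros, by conditioning on the residual. -/

section ZeroCount

variable {Ω : Type*} [MeasurableSpace Ω] {P : Measure Ω} {ξ : ℤ → Ω → ℂ} {γ : ℤ → ℂ}
  {F : Measure ℝ}

lemma aemeasurable_seriesSum {S : Type*} [MeasurableSpace S] {ν : Measure S} {Y : S → ℕ → ℂ}
    {Z : S → ℂ} (hY : Measurable Y) (hZ : Measurable Z)
    (h : ∀ᵐ s ∂ν, ConvergesOnDisk (Y s) ∧ Z s ∈ unitDisk) :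
    AEMeasurable (fun s => seriesSum (Y s) (Z s)) ν ∧
      AEMeasurable (fun s => seriesDeriv (Y s) (Z s)) ν := by
  constructor
  · refine aemeasurable_of_tendsto_metrizable_ae Filter.atTop
      (f := fun n s => ∑ k ∈ Finset.range n, Y s k * Z s ^ k)
      (fun n => Measurable.aemeasurable (by fun_prop)) ?_
    filter_upwards [h] with s hs
    exact (hs.1.hasSum hs.2).tendsto_sum_nat
  · refine aemeasurable_of_tendsto_metrizable_ae Filter.atTop
      (f := fun n s => ∑ k ∈ Finset.range n, Y s k * (k * Z s ^ (k - 1)))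
      (fun n => Measurable.aemeasurable (by fun_prop)) ?_
    filter_upwards [h] with s hs
    exact (hs.1.hasSum_deriv hs.2).tendsto_sum_nat

/-- The integrand of the area formula for `ratio γ y`, weighted by the complex normal density. -/
def areaDensity (γ : ℤ → ℂ) (y : ℕ → ℂ) (z : ℂ) : ℝ≥0∞ :=
  ENNReal.ofReal (complexNormalDensity 1 (ratio γ y z)) * ENNReal.ofReal (‖ratioDeriv γ y z‖ ^ 2)

lemma aemeasurable_areaDensity {S : Type*} [MeasurableSpace S] {ν : Measure S} {Y : S → ℕ → ℂ}
    {Z : S → ℂ} (hF : IsSpectralMeasure F γ) (hY : Measurable Y) (hZ : Measurable Z)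
    (h : ∀ᵐ s ∂ν, ConvergesOnDisk (Y s) ∧ Z s ∈ unitDisk) :
    AEMeasurable (fun s => areaDensity γ (Y s) (Z s)) ν := by
  obtain ⟨h1, h2⟩ := aemeasurable_seriesSum hY hZ h
  obtain ⟨h3, h4⟩ := aemeasurable_seriesSum (ν := ν) (Y := fun _ k => γ k) measurable_const hZ
    (h.mono fun s hs => ⟨hF.convergesOnDisk, hs.2⟩)
  have hr : AEMeasurable (fun s => ratio γ (Y s) (Z s)) ν := (h1.div h3).neg
  have hd : AEMeasurable (fun s => ratioDeriv γ (Y s) (Z s)) ν :=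
    ((h2.div h3).sub ((h1.mul h4).div (h3.pow_const 2))).neg
  exact ((continuous_complexNormalDensity 1).measurable.comp_aemeasurable hr).ennreal_ofReal.mul
    (hd.norm.pow_const 2).ennreal_ofReal

/-- The area formula for the solutions of `Y + w h = 0`, with `w` complex normal. -/
lemma lintegral_pointMeasure_regularizedSum (hF : IsSpectralMeasure F γ) (h0 : γ 0 = 1)
    {y : ℕ → ℂ} (hy : ConvergesOnDisk y) {A : Set ℂ} (hA : MeasurableSet A) (hAD : A ⊆ unitDisk) :
    ∫⁻ w, pointMeasure {z | z ∈ unitDisk ∧ regularizedSum (fun k : ℕ => y k + w * γ k) z = 0} A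
      ∂(volume.withDensity fun w => ENNReal.ofReal (complexNormalDensity 1 w)) =
      ∫⁻ z in A, areaDensity γ y z := by
  have hp : Measurable fun w => ENNReal.ofReal (complexNormalDensity 1 w) :=
    (continuous_complexNormalDensity 1).measurable.ennreal_ofReal
  have hm : Measurable fun w : ℂ => pointMeasure
      {z | z ∈ unitDisk ∧ regularizedSum (fun k : ℕ => y k + w * γ k) z = 0} A :=
    (measurable_pointMeasure_regularizedSum hA hAD).comp
      (measurable_pi_iff.2 fun k => by fun_prop)
  rw [lintegral_withDensity_eq_lintegral_mul _ hp hm]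
  -- Since `γ 0 = 1`, this excludes just the single level at which the constant term vanishes and
  -- the regularized sum differs from the series.
  have hne : ∀ᵐ w : ℂ, w ≠ -y 0 := by
    rw [ae_iff]
    simp
  have hset : ∀ᵐ w : ℂ, ENNReal.ofReal (complexNormalDensity 1 w) *
      pointMeasure {z | z ∈ unitDisk ∧ regularizedSum (fun k : ℕ => y k + w * γ k) z = 0} A =
      ENNReal.ofReal (complexNormalDensity 1 w) *
      pointMeasure {z | z ∈ unitDisk ∧ ratio γ y z = w} A := by
    filter_upwards [hne] with w hw
    suffices h : {z | z ∈ unitDisk ∧ regularizedSum (fun k : ℕ => y k + w * γ k) z = 0} =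
        {z | z ∈ unitDisk ∧ ratio γ y z = w} by rw [h]
    ext z
    refine and_congr_right fun hz => ?_
    have hg : ConvergesOnDisk (fun k : ℕ => y k + w * γ k) ∧ y 0 + w * γ (0 : ℕ) ≠ 0 := by
      refine ⟨hy.add_const_mul hF.convergesOnDisk w, fun h => hw ?_⟩
      rw [Nat.cast_zero, h0, mul_one] at h
      exact (neg_eq_of_add_eq_zero_right h).symm
    have hH := hF.seriesSum_covariance_ne_zero hz
    rw [regularizedSum, if_pos hg, hy.seriesSum_add_const_mul hF.convergesOnDisk w hz, ratio,
      neg_eq_iff_eq_neg, div_eq_iff hH, neg_mul, add_eq_zero_iff_eq_neg]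
  refine (lintegral_congr_ae hset).trans ?_
  rw [lintegral_mul_pointMeasure_fiber isOpen_unitDisk (fun z hz =>
    (hasDerivAt_ratio hF hy hz).differentiableAt.differentiableWithinAt) hAD hA hp]
  refine setLIntegral_congr_fun hA fun z hz => ?_
  rw [(hasDerivAt_ratio hF hy (hAD hz)).deriv]
  rfl

namespace IsStationaryComplexGaussian

lemma ae_convergesOnDisk (hξ : IsStationaryComplexGaussian P ξ γ) :
    ∀ᵐ ω ∂P, ConvergesOnDisk fun k : ℕ => ξ k ω := by
  have : ∀ n : ℕ, ∀ᵐ ω ∂P, Summable fun k : ℕ => ‖ξ k ω‖ * (1 - 1 / ((n : ℝ) + 1)) ^ k :=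
    fun n => by
      have h0 := one_sub_one_div_nonneg n
      have h1 : 1 - 1 / ((n : ℝ) + 1) < 1 := by
        rw [sub_lt_self_iff]; positivity
      have hu : Summable fun k : ℕ => ‖((1 - 1 / ((n : ℝ) + 1) : ℝ) : ℂ) ^ k‖ := by
        simpa only [norm_pow, Complex.norm_real, Real.norm_of_nonneg h0] using
          summable_geometric_of_lt_one h0 h1
      filter_upwards [hξ.ae_summable_norm hu] with ω hω
      simpa only [norm_pow, Complex.norm_real, Real.norm_of_nonneg h0, mul_comm] using hω
  filter_upwards [ae_all_iff.2 this] with ω hω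
  exact convergesOnDisk_of_summable hω

lemma map_zero_eq (hξ : IsStationaryComplexGaussian P ξ γ) :
    P.map (ξ 0) = volume.withDensity fun w => ENNReal.ofReal (complexNormalDensity 1 w) :=
  map_eq_withDensity_of_circular (hξ.gaussian.hasGaussianLaw_eval 0) (hξ.centered 0)
    (hξ.circular 0 0) one_pos (hξ.integral_norm_sq 0)

lemma ae_zero_ne_zero (hξ : IsStationaryComplexGaussian P ξ γ) : ∀ᵐ ω ∂P, ξ 0 ω ≠ 0 := by
  have h : ∀ᵐ w ∂(P.map (ξ 0)), w ≠ 0 := by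
    rw [hξ.map_zero_eq]
    have h' : ∀ᵐ w : ℂ, w ≠ 0 := by
      rw [ae_iff]
      simp
    exact (withDensity_absolutelyContinuous _ _).ae_le h'
  exact ae_of_ae_map (hξ.gaussian.aemeasurable 0) h

lemma aemeasurable_residual (hξ : IsStationaryComplexGaussian P ξ γ) (k : ℕ) :
    AEMeasurable (residual ξ γ k) P :=
  (hξ.gaussian.aemeasurable k).add ((hξ.gaussian.aemeasurable 0).neg.mul_const _)

/-- Subtracting `ξ_0 γ(k)` cancels the covariance with `ξ_0`, because `γ(-k) = conj γ(k)` and `γ(0)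
= 1`; circularity handles the pseudo-covariance. For a jointly Gaussian family this gives
independence of the whole sequence. -/
lemma indepFun_residual (hξ : IsStationaryComplexGaussian P ξ γ) :
    IndepFun (ξ 0) (fun ω k => residual ξ γ k ω) P := by
  have := hξ.isProbabilityMeasure
  have hR : ∀ k, MemLp (residual ξ γ k) 2 P := fun k =>
    (hξ.memLp_two k).add ((hξ.memLp_two 0).neg.mul_const _)
  have h2 : ∀ k l : ℤ, Integrable (fun ω => ξ k ω * ξ l ω) P := fun k l =>
    (hξ.memLp_two k).integrable_mul (hξ.memLp_two l)
  have h2c : ∀ k l : ℤ, Integrable (fun ω => ξ k ω * conj (ξ l ω)) P := fun k l =>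
    (hξ.memLp_two k).integrable_mul (memLp_conj (hξ.memLp_two l))
  have hG : IsGaussianProcess (Sum.elim (fun _ : Unit => ξ 0) (residual ξ γ)) P := by
    classical
    refine hξ.gaussian.of_isGaussianProcess fun s => ?_
    rcases s with s | k
    · exact ⟨{0}, ContinuousLinearMap.proj ⟨0, by simp⟩, fun ω => rfl⟩
    · refine ⟨{(k : ℤ), 0}, ContinuousLinearMap.proj (R := ℝ) (φ := fun _ => ℂ) ⟨k, by simp⟩ -
        ((ContinuousLinearMap.mul ℝ ℂ).flip (γ k)).comp
          (ContinuousLinearMap.proj (R := ℝ) (φ := fun _ => ℂ) ⟨0, by simp⟩), fun ω => ?_⟩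
      simp [residual, sub_eq_add_neg, mul_comm]
  have hind := hG.indepFun_of_covariance_inner (fun _ => hξ.gaussian.aemeasurable 0)
    hξ.aemeasurable_residual fun _ k x y => by
      refine covariance_inner_eq_zero (hξ.memLp_two 0) (hR k) (hξ.centered 0) ?_ ?_ x y
      · have : ∀ ω, ξ 0 ω * residual ξ γ k ω = ξ 0 ω * ξ k ω - γ k * (ξ 0 ω * ξ 0 ω) := fun ω => by
          rw [residual]; ring
        simp_rw [this]
        rw [integral_sub (h2 0 k) ((h2 0 0).const_mul _), integral_const_mul, hξ.circular,
          hξ.circular]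
        simp
      · have : ∀ ω, ξ 0 ω * conj (residual ξ γ k ω) =
            ξ 0 ω * conj (ξ k ω) - conj (γ k) * (ξ 0 ω * conj (ξ 0 ω)) := fun ω => by
          simp only [residual, map_add, map_mul, map_neg]; ring
        have hsymm : γ (0 - k) = conj (γ k) := by
          rw [← hξ.covariance, ← sub_zero (k : ℤ), ← hξ.covariance, ← integral_conj]
          congr with ω
          simp [mul_comm]
        simp_rw [this]
        rw [integral_sub (h2c 0 k) ((h2c 0 0).const_mul _), integral_const_mul, hξ.covariance,
          hξ.covariance, hsymm, sub_self, hξ.normalized]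
        ring
  exact hind.comp (measurable_pi_apply ()) measurable_id

lemma zeroProcess_ae_eq (hξ : IsStationaryComplexGaussian P ξ γ) :
    ∀ᵐ ω ∂P, zeroProcess ξ ω =
      pointMeasure {z | z ∈ unitDisk ∧ regularizedSum (fun k : ℕ => ξ k ω) z = 0} := by
  filter_upwards [hξ.ae_convergesOnDisk, hξ.ae_zero_ne_zero] with ω h1 h2
  have : zeroSet ξ ω = {z | z ∈ unitDisk ∧ regularizedSum (fun k : ℕ => ξ k ω) z = 0} := by
    ext z
    refine and_congr_right fun hz => ?_
    rw [regularizedSum, if_pos ⟨h1, by simpa using h2⟩]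
    rfl
  rw [← this]
  rfl

lemma aemeasurable_zeroProcess (hξ : IsStationaryComplexGaussian P ξ γ) {A : Set ℂ}
    (hA : MeasurableSet A) (hAD : A ⊆ unitDisk) : AEMeasurable (fun ω => zeroProcess ξ ω A) P := by
  refine ((measurable_pointMeasure_regularizedSum hA hAD).comp_aemeasurable
    (aemeasurable_pi_iff.2 fun k : ℕ => hξ.gaussian.aemeasurable k)).congr ?_
  filter_upwards [hξ.zeroProcess_ae_eq] with ω hω
  rw [hω]
  rfl

lemma ae_convergesOnDisk_residual (hξ : IsStationaryComplexGaussian P ξ γ)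
    (hF : IsSpectralMeasure F γ) : ∀ᵐ ω ∂P, ConvergesOnDisk fun k => residual ξ γ k ω := by
  filter_upwards [hξ.ae_convergesOnDisk] with ω hω
  exact hω.add_const_mul hF.convergesOnDisk _

/-- Adding a multiple of `h` to a series shifts its ratio by a constant: hence `-Y / h = ξ_0 - X /
h` and its derivative is that of `-X / h`, two linear forms in `ξ`. -/
lemma lintegral_areaDensity (hξ : IsStationaryComplexGaussian P ξ γ) (hF : IsSpectralMeasure F γ)
    {z : ℂ} (hz : z ∈ unitDisk) :
    ∫⁻ ω, areaDensity γ (fun k => residual ξ γ k ω) z ∂P = ENNReal.ofReal (intensity F z) := by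
  have hU2 := hξ.memLp_linearForm (summable_norm_ratioCoeff γ hz)
  have hV2 := hξ.memLp_linearForm (summable_norm_ratioDerivCoeff γ hz)
  set U := linearForm ξ (ratioCoeff γ z) with hU
  set V := linearForm ξ (ratioDerivCoeff γ z) with hV
  have hH := hF.seriesSum_covariance_ne_zero hz
  have key : ∀ᵐ ω ∂P, areaDensity γ (fun k => residual ξ γ k ω) z =
      ENNReal.ofReal (1 / π * (Real.exp (-‖U ω‖ ^ 2) * ‖V ω‖ ^ 2)) := by
    filter_upwards [hξ.ae_convergesOnDisk] with ω hω
    have hUω : U ω = ξ 0 ω - seriesSum (fun k : ℕ => ξ k ω) z / seriesSum (fun k : ℕ => γ k) z :=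
      tsum_ratioCoeff_mul γ hω hz
    have hVω : V ω = ratioDeriv γ (fun k : ℕ => ξ k ω) z := tsum_ratioDerivCoeff_mul γ hω hz
    have h1 : ratio γ (fun k => residual ξ γ k ω) z = U ω := by
      simp only [residual]
      rw [hUω, ratio, hω.seriesSum_add_const_mul hF.convergesOnDisk _ hz]
      field_simp
      ring
    have h2 : ratioDeriv γ (fun k => residual ξ γ k ω) z = V ω := by
      simp only [residual]
      rw [hVω, ratioDeriv, ratioDeriv, hω.seriesSum_add_const_mul hF.convergesOnDisk _ hz,
        hω.seriesDeriv_add_const_mul hF.convergesOnDisk _ hz]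
      field_simp
      ring
    rw [areaDensity, h1, h2, ← ENNReal.ofReal_mul (complexNormalDensity_nonneg one_pos _),
      complexNormalDensity]
    congr 1
    ring_nf
  have hi : Integrable (fun ω => Real.exp (-‖U ω‖ ^ 2) * ‖V ω‖ ^ 2) P := by
    have hm := hU2.1.norm
    refine (integrable_norm_sq hV2).bdd_mul (c := 1) ?_ (.of_forall fun ω => ?_)
    · exact Real.continuous_exp.comp_aestronglyMeasurable (hm.pow 2).neg
    · rw [Real.norm_of_nonneg (Real.exp_nonneg _)]
      exact Real.exp_le_one_iff.2 (by simp)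
  rw [lintegral_congr_ae key, ← ofReal_integral_eq_lintegral_ofReal (hi.const_mul _)
    (.of_forall fun ω => by positivity), integral_const_mul, integral_exp_ratio hξ hF hz]

/-- The mean number of zeros in a Borel set. -/
theorem lintegral_zeroProcess (hξ : IsStationaryComplexGaussian P ξ γ) (hF : IsSpectralMeasure F γ)
    {A : Set ℂ} (hA : MeasurableSet A) (hAD : A ⊆ unitDisk) :
    ∫⁻ ω, zeroProcess ξ ω A ∂P = ∫⁻ z in A, ENNReal.ofReal (intensity F z) := by
  have := hξ.isProbabilityMeasure
  let T : (ℕ → ℂ) → ℝ≥0∞ := fun c => pointMeasure {z | z ∈ unitDisk ∧ regularizedSum c z = 0} A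
  have hT : Measurable T := measurable_pointMeasure_regularizedSum hA hAD
  have m0 := hξ.gaussian.aemeasurable 0
  have mR : AEMeasurable (fun ω k => residual ξ γ k ω) P :=
    aemeasurable_pi_iff.2 hξ.aemeasurable_residual
  set μR := P.map fun ω k => residual ξ γ k ω with hμR
  have : IsProbabilityMeasure μR := Measure.isProbabilityMeasure_map mR
  have : IsProbabilityMeasure (P.map (ξ 0)) := Measure.isProbabilityMeasure_map m0
  have hgood : ∀ᵐ y ∂μR, ConvergesOnDisk y := by
    rw [hμR, ae_map_iff mR measurableSet_convergesOnDisk]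
    exact hξ.ae_convergesOnDisk_residual hF
  -- Joint measurability in the level and the residual sequence justifies integrating over `ξ_0`
  -- with `Y` frozen.
  have hTm : Measurable fun p : ℂ × (ℕ → ℂ) => T fun k : ℕ => p.2 k + p.1 * γ k :=
    hT.comp (measurable_pi_iff.2 fun k => by fun_prop)
  calc ∫⁻ ω, zeroProcess ξ ω A ∂P
      = ∫⁻ ω, T (fun k : ℕ => residual ξ γ k ω + ξ 0 ω * γ k) ∂P := by
        refine lintegral_congr_ae ?_
        filter_upwards [hξ.zeroProcess_ae_eq] with ω hω
        simp_rw [residual_add]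
        rw [hω]
    _ = ∫⁻ p, T (fun k : ℕ => p.2 k + p.1 * γ k) ∂((P.map (ξ 0)).prod μR) := by
        rw [← (indepFun_iff_map_prod_eq_prod_map_map m0 mR).1 hξ.indepFun_residual,
          lintegral_map' hTm.aemeasurable (m0.prodMk mR)]
    _ = ∫⁻ y, ∫⁻ w, T (fun k : ℕ => y k + w * γ k) ∂(P.map (ξ 0)) ∂μR :=
        lintegral_prod_symm _ hTm.aemeasurable
    _ = ∫⁻ y, (∫⁻ z in A, areaDensity γ y z) ∂μR := by
        refine lintegral_congr_ae ?_
        filter_upwards [hgood] with y hy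
        rw [hξ.map_zero_eq]
        exact lintegral_pointMeasure_regularizedSum hF hξ.normalized hy hA hAD
    _ = ∫⁻ z in A, ∫⁻ y, areaDensity γ y z ∂μR := by
        have h1 : ∀ᵐ z ∂(volume.restrict A), z ∈ unitDisk :=
          (ae_restrict_mem hA).mono fun z hz => hAD hz
        have h2 : ∀ᵐ p ∂(μR.prod (volume.restrict A)), ConvergesOnDisk p.1 ∧ p.2 ∈ unitDisk := by
          filter_upwards [Measure.quasiMeasurePreserving_fst.ae hgood,
            Measure.quasiMeasurePreserving_snd.ae h1] with p hp1 hp2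
          exact ⟨hp1, hp2⟩
        have hsw : AEMeasurable (Function.uncurry fun y z => areaDensity γ y z)
            (μR.prod (volume.restrict A)) :=
          aemeasurable_areaDensity hF measurable_fst measurable_snd h2
        exact lintegral_lintegral_swap hsw
    _ = ∫⁻ z in A, ENNReal.ofReal (intensity F z) := by
        refine setLIntegral_congr_fun hA fun z hz => ?_
        have hm : AEMeasurable (fun y => areaDensity γ y z) μR :=
          aemeasurable_areaDensity hF measurable_id measurable_const
            (hgood.mono fun y hy => ⟨hy, hAD hz⟩)
        rw [hμR, lintegral_map' hm mR]
        exact hξ.lintegral_areaDensity hF (hAD hz)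

end IsStationaryComplexGaussian

end ZeroCount

end GaussianPowerSeries

end

theorem proposition3p1 {Ω : Type*} [MeasurableSpace Ω] (P : Measure Ω) [IsProbabilityMeasure P]
    (ξ : ℤ → Ω → ℂ) (γ : ℤ → ℂ) (F : Measure ℝ)
    (hξ : GaussianPowerSeries.IsStationaryComplexGaussian P ξ γ)
    (hF : GaussianPowerSeries.IsSpectralMeasure F γ) :
    ∃ ρ : ℂ → ℝ,
      ContinuousOn ρ GaussianPowerSeries.unitDisk ∧
      GaussianPowerSeries.IsFirstIntensityOn P (GaussianPowerSeries.zeroProcess ξ)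
        GaussianPowerSeries.unitDisk ρ ∧
      ∀ r φ : ℝ, 0 ≤ r → r < 1 →
        ρ ((r : ℂ) * Complex.exp (Complex.I * (φ : ℂ))) =
          1 / (π * (1 - r ^ 2) ^ 2) *
            ((∫ t in Ioc (-π) π, ∫ s in Ioc (-π) π,
                (1 - Real.cos (t - s)) * GaussianPowerSeries.poissonKernel r s ^ 2 *
                  GaussianPowerSeries.poissonKernel r t ^ 2
                ∂(GaussianPowerSeries.rotate F φ) ∂(GaussianPowerSeries.rotate F φ)) /
              (∫ s in Ioc (-π) π, GaussianPowerSeries.poissonKernel r s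
                ∂(GaussianPowerSeries.rotate F φ)) ^ 2) := by
  have := hF.isProbabilityMeasure
  exact ⟨GaussianPowerSeries.intensity F, GaussianPowerSeries.continuousOn_intensity,
    ⟨fun z _ => GaussianPowerSeries.intensity_nonneg z,
      fun A hAD hA => hξ.aemeasurable_zeroProcess hA hAD,
      fun A hAD hA => hξ.lintegral_zeroProcess hF hA hAD⟩,
    fun r φ h0 h1 => GaussianPowerSeries.intensity_polar φ h0 h1⟩
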